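/- Let $\mathbf{k}$ be a nonzero commutative ring with identity and let $Z$ be a well-ordered set. Let $\mathfrak{S}(Z)$ be the free semigroup with two unary operators $D,P$ on $Z$; its elements (bracketed words) are the nonempty words in the letters $z\in Z$, $D(u)$, $P(u)$ with $u\in\mathfrak{S}(Z)$, and the breadth $|u|$ is the number of letters of $u$. Let $\mathbf{k}\mathfrak{S}(Z)$ be the free $\mathbf{k}$-module on $\mathfrak{S}(Z)$, with the bilinear extension of concatenation and the linear extensions of $D,P$ (the free nonunitary operated algebra). Let $\mathfrak{S}^\star(Z)$ be the set of words $q$ on $Z\sqcup\{\star\}$ in which $\star$ occurs exactly once; $q|_u$ is the result of replacing $\star$ by $u$, extended linearly to $u\in\mathbf{k}\mathfrak{S}(Z)$. *Orders.* For a word $u$, let $\deg_Z(u)$, $\deg_D(u)$, $\deg_P(u)$ be the numbers of occurrences in $u$ of elements of $Z$, of $D$, and of $P$ (with multiplicity). Let $\deg_{\rm ed}(u)$ be the sum over all brackets $D$ in $u$ of $k-1$, where $k$ is the number of occurrences of elements of $Z$ inside the bracket, and let $\deg_{\rm gp}(u)$ be the sum over all brackets $P$ in $u$ of $\deg_Z(u)-k$,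 with $k$ as before. Let $\le_{\rm Dlex}$ be the recursive degree-lexicographic order: words are compared first by breadth, then lexicographically letter by letter, where $z<P(u)<D(v)$ for $z\in Z$ and all words $u,v$, elements of $Z$ are compared in $Z$, and $P(u)<P(v)$, respectively $D(u)<D(v)$, iff $u<_{\rm Dlex}v$. Let $\le_{\rm zdp}$ be the order that compares successively $\deg_Z,\deg_{\rm ed},\deg_D,\deg_{\rm gp},\deg_P$ and finally $\le_{\rm Dlex}$. Let $\le'_{\rm zdp}$ be the order that compares successively $\deg_Z,\deg_{\rm ed},\deg_D,\deg_P,\deg_{\rm gp}$ and finally $\le_{\rm Dlex}$. A monomial order is a well order on $\mathfrak{S}(Z)$ such that $u<v$ implies $q|_u<q|_v$ for all $q\in\mathfrak{S}^\star(Z)$. *Gröbner–Shirshov bases.* Fix a well order $\le$ on $\mathfrak{S}(Z)$. Let $\bar f$ be the leading word of $f\neq0$; $f$ is monic if $\bar f$ has coefficient $1$. For a set $S$ of monic elements and $w\in\mathfrak{S}(Z)$, an element $f\in\mathbf{k}\mathfrak{S}(Z)$ is trivial modulo $(S,w)$ if it is a finite (possibly empty) sum $f=\sum_i c_i\,q_i|_{s_i}$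 with $0\ne c_i\in\mathbf{k}$, $q_i\in\mathfrak{S}^\star(Z)$, $s_i\in S$ and $q_i|_{\overline{s_i}}<w$. A set $S\subseteq\mathbf{k}\mathfrak{S}(Z)$ is a Gröbner–Shirshov basis with respect to $\le$ if all its elements are monic and, for all $f,g\in S$: (i) $f\mu-\nu g$ is trivial modulo $(S,w)$ whenever $\mu,\nu,w\in\mathfrak{S}(Z)$, $w=\bar f\mu=\nu\bar g$ and $\max\{|\bar f|,|\bar g|\}<|w|<|\bar f|+|\bar g|$; (ii) $f-q|_g$ is trivial modulo $(S,w)$ whenever $q\in\mathfrak{S}^\star(Z)$ and $w=\bar f=q|_{\bar g}$. *Theorem.* Let $\lambda,b\in\mathbf{k}$ be of type I ($\lambda=0$, $b=0$), type II ($\lambda\ne0$, $b=0$) or type III ($\lambda=0$, $b\neq0$). Let $S_\Phi(Z)\subseteq\mathbf{k}\mathfrak{S}(Z)$ be the set of all elements $$P(u)P(v)-P(uP(v))-P(P(u)v)-\lambda P(uv),$$ $$D(uv)-D(u)v-uD(v)-\lambda D(u)D(v),$$ $$D(P(u))-P(D(u))-bP(u),$$ with $u,v\in\mathfrak{S}(Z)$.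 Then: 1. $\le_{\rm zdp}$ is a well order on $\mathfrak{S}(Z)$, and $S_\Phi(Z)$ is a Gröbner–Shirshov basis in $\mathbf{k}\mathfrak{S}(Z)$ with respect to $\le_{\rm zdp}$. 2. $\le'_{\rm zdp}$ is a monomial order on $\mathfrak{S}(Z)$, and $S_\Phi(Z)$ is a Gröbner–Shirshov basis in $\mathbf{k}\mathfrak{S}(Z)$ with respect to $\le'_{\rm zdp}$. -/

import Mathlib

/-! ### Free operated semigroups: bracketed words -/

universe uOp uGen

mutual
/-- The letters of bracketed words: an element of `Z`, or a bracket `⌊u⌋_ω` around a word `u`. -/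
inductive OpLetter (Ω : Type uOp) (Z : Type uGen)
  | var (z : Z) : OpLetter Ω Z
  | op (ω : Ω) (u : OpWord Ω Z) : OpLetter Ω Z
/-- Bracketed words on `Z` with brackets indexed by `Ω`: nonempty finite words in the letters
`Z ⊔ ⌊OpWord⌋_Ω`. This is the free `Ω`-operated semigroup on `Z`. -/
inductive OpWord (Ω : Type uOp) (Z : Type uGen)
  | single (a : OpLetter Ω Z) : OpWord Ω Z
  | cons (a : OpLetter Ω Z) (u : OpWord Ω Z) : OpWord Ω Z
end

namespace OpWord

variable {Ω X Z : Type*}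

/-- The one-letter word `z`. -/
def var (z : Z) : OpWord Ω Z := single (.var z)

/-- The bracket operator `u ↦ ⌊u⌋_ω`. -/
def bracket (ω : Ω) (u : OpWord Ω Z) : OpWord Ω Z := single (.op ω u)

/-- Concatenation of words. -/
def append : OpWord Ω Z → OpWord Ω Z → OpWord Ω Z
  | single a, v => cons a v
  | cons a u, v => cons a (append u v)

instance : Mul (OpWord Ω Z) := ⟨append⟩

theorem single_mul (a : OpLetter Ω Z) (v : OpWord Ω Z) : single a * v = cons a v := rfl

theorem cons_mul (a : OpLetter Ω Z) (u v : OpWord Ω Z) : cons a u * v = cons a (u * v) := rfl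

theorem append_assoc' : ∀ u v w : OpWord Ω Z, u * v * w = u * (v * w)
  | single _, _, _ => rfl
  | cons a u, v, w => by rw [cons_mul, cons_mul, cons_mul, append_assoc' u v w]

instance : Semigroup (OpWord Ω Z) := ⟨append_assoc'⟩

/-- The breadth of a word: its number of letters. -/
def breadth : OpWord Ω Z → ℕ
  | single _ => 1
  | cons _ u => u.breadth + 1

end OpWord

mutual
/-- Auxiliary to `OpWord.subst`. -/
def OpLetter.subst {Ω X Z : Type*} (σ : X → OpWord Ω Z) : OpLetter Ω X → OpWord Ω Z
  | .var x => σ x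
  | .op ω u => OpWord.bracket ω (OpWord.subst σ u)
/-- Substitution of words for variables: the morphism of operated semigroups extending `σ`. -/
def OpWord.subst {Ω X Z : Type*} (σ : X → OpWord Ω Z) : OpWord Ω X → OpWord Ω Z
  | .single a => OpLetter.subst σ a
  | .cons a u => OpLetter.subst σ a * OpWord.subst σ u
end

mutual
/-- Auxiliary to `OpWord.starCount`. -/
def OpLetter.starCount {Ω Z : Type*} : OpLetter Ω (Option Z) → ℕ
  | .var none => 1
  | .var (some _) => 0
  | .op _ u => OpWord.starCount u
/-- The number of occurrences of the symbol `⋆ = none` in a word on `Z ∪ {⋆} = Option Z`. -/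
def OpWord.starCount {Ω Z : Type*} : OpWord Ω (Option Z) → ℕ
  | .single a => OpLetter.starCount a
  | .cons a u => OpLetter.starCount a + OpWord.starCount u
end

/-- `⋆`-bracketed words: words on `Z ∪ {⋆}` in which `⋆` occurs exactly once. -/
def StarWord (Ω Z : Type*) : Type _ := {q : OpWord Ω (Option Z) // q.starCount = 1}

/-- `q|_u`: replace `⋆` in `q` by the word `u`. -/
def StarWord.plug {Ω Z : Type*} (q : StarWord Ω Z) (u : OpWord Ω Z) : OpWord Ω Z :=
  q.1.subst (fun z => z.elim u OpWord.var)

/-! ### Free operated algebras: bracketed polynomials -/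

/-- Bracketed polynomials: the free `k`-module on bracketed words, with the bilinear extension of
concatenation; this is the free nonunitary `Ω`-operated `k`-algebra on `Z`. -/
abbrev OpPoly (k : Type*) [CommRing k] (Ω Z : Type*) := MonoidAlgebra k (OpWord Ω Z)

noncomputable section

namespace OpPoly

variable {k : Type*} [CommRing k] {Ω X Z : Type*}

/-- A word as a polynomial. -/
def ofWord (u : OpWord Ω Z) : OpPoly k Ω Z := MonoidAlgebra.single u 1

/-- The linear extension of the bracket operator. -/
def bracket (ω : Ω) (f : OpPoly k Ω Z) : OpPoly k Ω Z :=
  MonoidAlgebra.mapDomain (OpWord.bracket ω) f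

/-- The instance of a bracketed polynomial obtained by substituting words for its variables. -/
def subst (σ : X → OpWord Ω Z) (f : OpPoly k Ω X) : OpPoly k Ω Z :=
  MonoidAlgebra.mapDomain (OpWord.subst σ) f

/-- `q|_f = ∑ cᵢ q|_{uᵢ}` for `f = ∑ cᵢ uᵢ`. -/
def plug (q : StarWord Ω Z) (f : OpPoly k Ω Z) : OpPoly k Ω Z :=
  MonoidAlgebra.mapDomain q.plug f

/-- The set `S_Φ(Z)` of all substitution instances in `Z` of a set `Φ` of operated polynomial
identities in the variables `X`. -/
def instances (Φ : Set (OpPoly k Ω X)) (Z : Type*) : Set (OpPoly k Ω Z) :=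
  {f | ∃ φ ∈ Φ, ∃ σ : X → OpWord Ω Z, f = subst σ φ}

/-- `m` is the leading word of `f` for the order `le`. -/
def IsLeading (le : OpWord Ω Z → OpWord Ω Z → Prop) (f : OpPoly k Ω Z) (m : OpWord Ω Z) : Prop :=
  f.coeff m ≠ 0 ∧ ∀ u, f.coeff u ≠ 0 → le u m

/-- `f` has a leading word, with coefficient `1`. -/
def IsMonic (le : OpWord Ω Z → OpWord Ω Z → Prop) (f : OpPoly k Ω Z) : Prop :=
  ∃ m, IsLeading le f m ∧ f.coeff m = 1

/-- `f` is trivial modulo `(S, w)`: `f = ∑ cᵢ qᵢ|_{sᵢ}` with `cᵢ ≠ 0`, `sᵢ ∈ S` and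
`qᵢ|_{lead sᵢ} < w`. -/
def IsTrivialMod (le : OpWord Ω Z → OpWord Ω Z → Prop) (S : Set (OpPoly k Ω Z)) (w : OpWord Ω Z)
    (f : OpPoly k Ω Z) : Prop :=
  ∃ (n : ℕ) (c : Fin n → k) (q : Fin n → StarWord Ω Z) (s : Fin n → OpPoly k Ω Z),
    (∀ i, c i ≠ 0 ∧ s i ∈ S ∧
      ∃ m, IsLeading le (s i) m ∧ le ((q i).plug m) w ∧ (q i).plug m ≠ w) ∧
    f = ∑ i, c i • plug (q i) (s i)

/-- Gröbner–Shirshov bases with respect to a linear order `le` on words: a set of monic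
polynomials all of whose intersection compositions `f μ - ν g`, with ambiguity `w = f̄ μ = ν ḡ`,
and including compositions `f - q|_g`, with ambiguity `w = f̄ = q|_ḡ`, are trivial modulo
`(S, w)`. -/
structure IsGroebnerShirshovBasis (le : OpWord Ω Z → OpWord Ω Z → Prop)
    (S : Set (OpPoly k Ω Z)) : Prop where
  monic : ∀ f ∈ S, IsMonic le f
  intersection : ∀ f ∈ S, ∀ g ∈ S, ∀ mf mg : OpWord Ω Z,
    IsLeading le f mf → IsLeading le g mg → ∀ μ ν w : OpWord Ω Z,
      w = mf * μ → w = ν * mg →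
      max mf.breadth mg.breadth < w.breadth → w.breadth < mf.breadth + mg.breadth →
      IsTrivialMod le S w (f * ofWord μ - ofWord ν * g)
  including : ∀ f ∈ S, ∀ g ∈ S, ∀ mf mg : OpWord Ω Z,
    IsLeading le f mf → IsLeading le g mg → ∀ (q : StarWord Ω Z) (w : OpWord Ω Z),
      w = mf → w = q.plug mg →
      IsTrivialMod le S w (f - plug q g)

end OpPoly

end

/-- `le` is a linear order whose strict part is well-founded. -/
def IsWellLinearOrder {W : Type*} (le : W → W → Prop) : Prop :=
  IsLinearOrder W le ∧ WellFounded (fun u v => le u v ∧ u ≠ v)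

/-- Monomial orders: well orders on words with `u < v → q|_u < q|_v` for all `⋆`-words `q`. -/
def IsMonomialOrder {Ω Z : Type*} (le : OpWord Ω Z → OpWord Ω Z → Prop) : Prop :=
  IsWellLinearOrder le ∧
    ∀ (q : StarWord Ω Z) (u v : OpWord Ω Z), le u v → u ≠ v →
      le (q.plug u) (q.plug v) ∧ q.plug u ≠ q.plug v

/-! ### The order on words in two operators `D` and `P` -/

/-- The two operator symbols. -/
inductive PDOp
  | D
  | P

mutual
/-- Auxiliary to `OpWord.degZ`. -/
def OpLetter.degZ {Ω Z : Type*} : OpLetter Ω Z → ℕ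
  | .var _ => 1
  | .op _ u => OpWord.degZ u
/-- The number of occurrences of elements of `Z`, counted with multiplicity. -/
def OpWord.degZ {Ω Z : Type*} : OpWord Ω Z → ℕ
  | .single a => OpLetter.degZ a
  | .cons a u => OpLetter.degZ a + OpWord.degZ u
end

mutual
/-- Auxiliary to `OpWord.degD`. -/
def OpLetter.degD {Z : Type*} : OpLetter PDOp Z → ℕ
  | .var _ => 0
  | .op .D u => OpWord.degD u + 1
  | .op .P u => OpWord.degD u
/-- The number of occurrences of `D`. -/
def OpWord.degD {Z : Type*} : OpWord PDOp Z → ℕ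
  | .single a => OpLetter.degD a
  | .cons a u => OpLetter.degD a + OpWord.degD u
end

mutual
/-- Auxiliary to `OpWord.degP`. -/
def OpLetter.degP {Z : Type*} : OpLetter PDOp Z → ℕ
  | .var _ => 0
  | .op .D u => OpWord.degP u
  | .op .P u => OpWord.degP u + 1
/-- The number of occurrences of `P`. -/
def OpWord.degP {Z : Type*} : OpWord PDOp Z → ℕ
  | .single a => OpLetter.degP a
  | .cons a u => OpLetter.degP a + OpWord.degP u
end

mutual
/-- Auxiliary to `OpWord.degED`. -/
def OpLetter.degED {Z : Type*} : OpLetter PDOp Z → ℕ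
  | .var _ => 0
  | .op .D u => OpWord.degED u + (OpWord.degZ u - 1)
  | .op .P u => OpWord.degED u
/-- The ED-degree: the sum, over all brackets `D` in the word, of `k - 1` where `k ≥ 1` is the
number of elements of `Z` inside the bracket. -/
def OpWord.degED {Z : Type*} : OpWord PDOp Z → ℕ
  | .single a => OpLetter.degED a
  | .cons a u => OpLetter.degED a + OpWord.degED u
end

mutual
/-- Auxiliary to `OpWord.degGPIn`. -/
def OpLetter.degGPIn {Z : Type*} (n : ℕ) : OpLetter PDOp Z → ℕ
  | .var _ => 0
  | .op .D u => OpWord.degGPIn n u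
  | .op .P u => OpWord.degGPIn n u + (n - OpWord.degZ u)
/-- The sum, over all brackets `P` in the word, of `n - k` where `k` is the number of elements
of `Z` inside the bracket. -/
def OpWord.degGPIn {Z : Type*} (n : ℕ) : OpWord PDOp Z → ℕ
  | .single a => OpLetter.degGPIn n a
  | .cons a u => OpLetter.degGPIn n a + OpWord.degGPIn n u
end

/-- The GP-degree: the sum, over all brackets `P` in the word `u`, of the number of elements of
`Z` that occur in `u` outside the bracket. -/
def OpWord.degGP {Z : Type*} (u : OpWord PDOp Z) : ℕ := u.degGPIn u.degZ

mutual
/-- The strict order on letters: `Z` in its own order, then the brackets `P(u)`, then the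
brackets `D(u)`; brackets of the same kind are compared through their contents. -/
def OpLetter.dlexLT {Z : Type*} [LT Z] : OpLetter PDOp Z → OpLetter PDOp Z → Prop
  | .var z, .var z' => z < z'
  | .var _, .op _ _ => True
  | .op _ _, .var _ => False
  | .op .P u, .op .P v => OpWord.dlexLT u v
  | .op .P _, .op .D _ => True
  | .op .D _, .op .P _ => False
  | .op .D u, .op .D v => OpWord.dlexLT u v
/-- The strict (recursive) degree-lexicographic order: words are compared first by breadth, and
words of equal breadth are compared lexicographically, letter by letter. -/
def OpWord.dlexLT {Z : Type*} [LT Z] : OpWord PDOp Z → OpWord PDOp Z → Prop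
  | .single a, .single b => OpLetter.dlexLT a b
  | .single _, .cons _ _ => True
  | .cons _ _, .single _ => False
  | .cons a u, .cons b v =>
      u.breadth < v.breadth ∨
        (u.breadth = v.breadth ∧ (OpLetter.dlexLT a b ∨ (a = b ∧ OpWord.dlexLT u v)))
end

namespace OpWord

variable {Z : Type*} [LT Z]

/-- The recursive degree-lexicographic order. -/
def dlexLE (u v : OpWord PDOp Z) : Prop := dlexLT u v ∨ u = v

/-- The order `≤_zdp`: compare successively the degree in `Z`, the ED-degree, the `D`-degree, the
GP-degree, the `P`-degree, and finally the words degree-lexicographically. -/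
def zdpLE (u v : OpWord PDOp Z) : Prop :=
  u.degZ < v.degZ ∨
  (u.degZ = v.degZ ∧ u.degED < v.degED) ∨
  (u.degZ = v.degZ ∧ u.degED = v.degED ∧ u.degD < v.degD) ∨
  (u.degZ = v.degZ ∧ u.degED = v.degED ∧ u.degD = v.degD ∧ u.degGP < v.degGP) ∨
  (u.degZ = v.degZ ∧ u.degED = v.degED ∧ u.degD = v.degD ∧ u.degGP = v.degGP ∧
    u.degP < v.degP) ∨
  (u.degZ = v.degZ ∧ u.degED = v.degED ∧ u.degD = v.degD ∧ u.degGP = v.degGP ∧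
    u.degP = v.degP ∧ dlexLE u v)

/-- The variant of `≤_zdp` in which the `P`-degree is compared before the GP-degree. -/
def zdpLE' (u v : OpWord PDOp Z) : Prop :=
  u.degZ < v.degZ ∨
  (u.degZ = v.degZ ∧ u.degED < v.degED) ∨
  (u.degZ = v.degZ ∧ u.degED = v.degED ∧ u.degD < v.degD) ∨
  (u.degZ = v.degZ ∧ u.degED = v.degED ∧ u.degD = v.degD ∧ u.degP < v.degP) ∨
  (u.degZ = v.degZ ∧ u.degED = v.degED ∧ u.degD = v.degD ∧ u.degP = v.degP ∧
    u.degGP < v.degGP) ∨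
  (u.degZ = v.degZ ∧ u.degED = v.degED ∧ u.degD = v.degD ∧ u.degP = v.degP ∧
    u.degGP = v.degGP ∧ dlexLE u v)

end OpWord

/-! ### The defining identities of para-differential Rota–Baxter algebras -/

noncomputable section

namespace ParaDRB

variable {k : Type*} [CommRing k]

/-- The variable `x`. -/
def x : OpPoly k PDOp (Fin 2) := OpPoly.ofWord (OpWord.var 0)

/-- The variable `y`. -/
def y : OpPoly k PDOp (Fin 2) := OpPoly.ofWord (OpWord.var 1)

/-- The operator `D`. -/
def D (f : OpPoly k PDOp (Fin 2)) : OpPoly k PDOp (Fin 2) := OpPoly.bracket PDOp.D f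

/-- The operator `P`. -/
def P (f : OpPoly k PDOp (Fin 2)) : OpPoly k PDOp (Fin 2) := OpPoly.bracket PDOp.P f

/-- The Rota–Baxter identity of weight `lam`. -/
def rotaBaxter (lam : k) : OpPoly k PDOp (Fin 2) :=
  P x * P y - P (x * P y) - P (P x * y) - lam • P (x * y)

/-- The Leibniz rule of weight `lam`. -/
def leibniz (lam : k) : OpPoly k PDOp (Fin 2) :=
  D (x * y) - D x * y - x * D y - lam • (D x * D y)

/-- The commutation relation `DP - PD - bP`. -/
def commutation (b : k) : OpPoly k PDOp (Fin 2) :=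
  D (P x) - P (D x) - b • P x

/-- The set of the three defining identities with parameters `lam` and `b`. -/
def identities (lam b : k) : Set (OpPoly k PDOp (Fin 2)) :=
  {rotaBaxter lam, leibniz lam, commutation b}

/-- The three types of para-differential Rota–Baxter algebras. -/
inductive AlgType
  | I
  | II
  | III

/-- The parameters allowed for each type. -/
def AlgType.Admissible : AlgType → k → k → Prop
  | .I, lam, b => lam = 0 ∧ b = 0
  | .II, lam, b => lam ≠ 0 ∧ b = 0
  | .III, lam, b => lam = 0 ∧ b ≠ 0

end ParaDRB

end

namespace OpWord

variable {Ω X Z : Type*}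

@[simp] theorem breadth_single (a : OpLetter Ω Z) : (single a).breadth = 1 := rfl

@[simp] theorem breadth_cons (a : OpLetter Ω Z) (u : OpWord Ω Z) :
    (cons a u).breadth = u.breadth + 1 := rfl

@[simp] theorem breadth_bracket (ω : Ω) (u : OpWord Ω Z) : (bracket ω u).breadth = 1 := rfl

@[simp] theorem breadth_mul : ∀ u v : OpWord Ω Z, (u * v).breadth = u.breadth + v.breadth
  | single _, v => by rw [single_mul]; simp [add_comm]
  | cons _ u, v => by rw [cons_mul, breadth_cons, breadth_cons, breadth_mul u v]; omega

theorem breadth_pos : ∀ u : OpWord Ω Z, 0 < u.breadth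
  | single _ => Nat.one_pos
  | cons _ _ => Nat.succ_pos _

theorem bracket_inj {ω ω' : Ω} {u v : OpWord Ω Z} :
    bracket ω u = bracket ω' v ↔ ω = ω' ∧ u = v := by
  simp [bracket]

theorem bracket_ne_mul (ω : Ω) (x u v : OpWord Ω Z) : bracket ω x ≠ u * v := fun h => by
  have := congrArg breadth h
  have := u.breadth_pos
  have := v.breadth_pos
  simp at *
  omega

/-- Levi's lemma for words. -/
theorem mul_eq_mul_cases : ∀ {u v u' v' : OpWord Ω Z}, u * v = u' * v' →
    (u = u' ∧ v = v') ∨ (∃ t, u = u' * t ∧ v' = t * v) ∨ (∃ t, u' = u * t ∧ v = t * v')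
  | single a, v, single b, v', h => by
      rw [single_mul, single_mul] at h
      injection h with h₁ h₂
      exact .inl ⟨by rw [h₁], h₂⟩
  | single a, v, cons b u', v', h => by
      rw [single_mul, cons_mul] at h
      injection h with h₁ h₂
      exact .inr (.inr ⟨u', by rw [single_mul, h₁], h₂⟩)
  | cons a u, v, single b, v', h => by
      rw [single_mul, cons_mul] at h
      injection h with h₁ h₂
      exact .inr (.inl ⟨u, by rw [single_mul, h₁], h₂.symm⟩)
  | cons a u, v, cons b u', v', h => by
      rw [cons_mul, cons_mul] at h
      injection h with h₁ h₂
      subst h₁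
      rcases mul_eq_mul_cases h₂ with ⟨rfl, rfl⟩ | ⟨t, rfl, rfl⟩ | ⟨t, rfl, rfl⟩
      · exact .inl ⟨rfl, rfl⟩
      · exact .inr (.inl ⟨t, rfl, rfl⟩)
      · exact .inr (.inr ⟨t, rfl, rfl⟩)

theorem mul_eq_mul_of_breadth_eq {u v u' v' : OpWord Ω Z} (h : u * v = u' * v')
    (hu : u.breadth = u'.breadth) : u = u' ∧ v = v' := by
  rcases mul_eq_mul_cases h with h | ⟨t, rfl, -⟩ | ⟨t, rfl, -⟩
  · exact h
  all_goals
    have := t.breadth_pos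
    simp at hu
    omega

@[simp] theorem subst_var (σ : X → OpWord Ω Z) (x : X) : subst σ (var x) = σ x := by
  simp [var, subst, OpLetter.subst]

@[simp] theorem subst_bracket (σ : X → OpWord Ω Z) (ω : Ω) (u : OpWord Ω X) :
    subst σ (bracket ω u) = bracket ω (subst σ u) := by
  simp [bracket, subst, OpLetter.subst]

@[simp] theorem subst_mul (σ : X → OpWord Ω Z) :
    ∀ u v : OpWord Ω X, subst σ (u * v) = subst σ u * subst σ v
  | single a, v => by simp [single_mul, subst]
  | cons a u, v => by simp [cons_mul, subst, subst_mul σ u v, mul_assoc]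

@[simp] theorem starCount_mul :
    ∀ u v : OpWord Ω (Option Z), (u * v).starCount = u.starCount + v.starCount
  | single a, v => by simp [single_mul, starCount]
  | cons a u, v => by simp [cons_mul, starCount, starCount_mul u v, add_assoc]

@[simp] theorem starCount_bracket (ω : Ω) (u : OpWord Ω (Option Z)) :
    (bracket ω u).starCount = u.starCount := by
  simp [bracket, starCount, OpLetter.starCount]

end OpWord

mutual

theorem OpLetter.starCount_subst_some {Ω Z : Type*} : ∀ a : OpLetter Ω Z,
    (a.subst fun z => OpWord.var (some z)).starCount = 0
  | .var _ => by simp [OpLetter.subst, OpWord.var, OpWord.starCount, OpLetter.starCount]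
  | .op ω u => by simp [OpLetter.subst, OpWord.starCount_subst_some u]

theorem OpWord.starCount_subst_some {Ω Z : Type*} : ∀ u : OpWord Ω Z,
    (u.subst fun z => OpWord.var (some z)).starCount = 0
  | .single a => by simp [OpWord.subst, OpLetter.starCount_subst_some a]
  | .cons a u => by
      simp [OpWord.subst, OpLetter.starCount_subst_some a, OpWord.starCount_subst_some u]

end

mutual

theorem OpLetter.subst_subst_some {Ω Z : Type*} (u : OpWord Ω Z) : ∀ a : OpLetter Ω Z,
    (a.subst fun z => OpWord.var (some z)).subst (fun z => z.elim u OpWord.var) = .single a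
  | .var _ => by rw [OpLetter.subst, OpWord.subst_var]; rfl
  | .op ω v => by
      rw [OpLetter.subst, OpWord.subst_bracket, OpWord.subst_subst_some u v]; rfl

theorem OpWord.subst_subst_some {Ω Z : Type*} (u : OpWord Ω Z) : ∀ v : OpWord Ω Z,
    (v.subst fun z => OpWord.var (some z)).subst (fun z => z.elim u OpWord.var) = v
  | .single a => by simp [OpWord.subst, OpLetter.subst_subst_some u a]
  | .cons a v => by
      simp [OpWord.subst, OpLetter.subst_subst_some u a, OpWord.subst_subst_some u v,
        OpWord.single_mul]

end

mutual

theorem OpLetter.subst_congr_of_starCount_eq_zero {Ω Z : Type*} (u v : OpWord Ω Z) :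
    ∀ a : OpLetter Ω (Option Z), a.starCount = 0 →
      a.subst (fun z => z.elim u OpWord.var) = a.subst (fun z => z.elim v OpWord.var)
  | .var none, h => by simp [OpLetter.starCount] at h
  | .var (some _), _ => by simp [OpLetter.subst]
  | .op _ w, h => by
      rw [OpLetter.starCount] at h
      simp [OpLetter.subst, OpWord.subst_congr_of_starCount_eq_zero u v w h]

theorem OpWord.subst_congr_of_starCount_eq_zero {Ω Z : Type*} (u v : OpWord Ω Z) :
    ∀ w : OpWord Ω (Option Z), w.starCount = 0 →
      w.subst (fun z => z.elim u OpWord.var) = w.subst (fun z => z.elim v OpWord.var)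
  | .single a, h => by
      rw [OpWord.starCount] at h
      simp [OpWord.subst, OpLetter.subst_congr_of_starCount_eq_zero u v a h]
  | .cons a w, h => by
      rw [OpWord.starCount, add_eq_zero] at h
      simp [OpWord.subst, OpLetter.subst_congr_of_starCount_eq_zero u v a h.1,
        OpWord.subst_congr_of_starCount_eq_zero u v w h.2]

end

namespace OpWord

variable {Ω Z : Type*}

/-- Contexts: the maps on words obtained from the identity by multiplying by words on either side
and by applying brackets. They are the maps `u ↦ q|_u` for the `⋆`-words `q`. -/
inductive IsContext : (OpWord Ω Z → OpWord Ω Z) → Prop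
  | id : IsContext fun x => x
  | mul_left (a : OpWord Ω Z) {c} : IsContext c → IsContext fun x => a * c x
  | mul_right (b : OpWord Ω Z) {c} : IsContext c → IsContext fun x => c x * b
  | bracket (ω : Ω) {c} : IsContext c → IsContext fun x => OpWord.bracket ω (c x)

theorem IsContext.exists_starWord {c : OpWord Ω Z → OpWord Ω Z} (hc : IsContext c) :
    ∃ q : StarWord Ω Z, q.plug = c := by
  induction hc with
  | id => exact ⟨⟨var none, rfl⟩, by ext; simp [StarWord.plug]⟩
  | mul_left a _ ih =>
    obtain ⟨q, rfl⟩ := ih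
    exact ⟨⟨a.subst (fun z => var (some z)) * q.1, by simp [starCount_subst_some, q.2]⟩,
      by ext; simp [StarWord.plug, subst_subst_some]⟩
  | mul_right b _ ih =>
    obtain ⟨q, rfl⟩ := ih
    exact ⟨⟨q.1 * b.subst (fun z => var (some z)), by simp [starCount_subst_some, q.2]⟩,
      by ext; simp [StarWord.plug, subst_subst_some]⟩
  | bracket ω _ ih =>
    obtain ⟨q, rfl⟩ := ih
    exact ⟨⟨OpWord.bracket ω q.1, by simp [q.2]⟩, by ext; simp [StarWord.plug]⟩

/-- An occurrence of `g` in a bracketed word is the whole word or lies inside the bracket. -/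
theorem IsContext.eq_bracket {c : OpWord Ω Z → OpWord Ω Z} (hc : IsContext c) {ω : Ω}
    {x g : OpWord Ω Z} (h : OpWord.bracket ω x = c g) :
    (g = OpWord.bracket ω x ∧ c = fun x => x) ∨
      ∃ c', IsContext c' ∧ x = c' g ∧ c = fun y => OpWord.bracket ω (c' y) := by
  cases hc with
  | id => exact .inl ⟨h.symm, rfl⟩
  | mul_left a hc => exact absurd h (bracket_ne_mul _ _ _ _)
  | mul_right b hc => exact absurd h (bracket_ne_mul _ _ _ _)
  | @bracket ω' c hc =>
    obtain ⟨rfl, rfl⟩ := bracket_inj.1 h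
    exact .inr ⟨c, hc, rfl, rfl⟩

/-- An occurrence of `g` in a product `u * v` lies in `u`, lies in `v`, or overlaps both. -/
theorem IsContext.eq_mul {c : OpWord Ω Z → OpWord Ω Z} (hc : IsContext c) {g : OpWord Ω Z} :
    ∀ {u v : OpWord Ω Z}, u * v = c g →
    (∃ c', IsContext c' ∧ u = c' g ∧ c = fun x => c' x * v) ∨
    (∃ c', IsContext c' ∧ v = c' g ∧ c = fun x => u * c' x) ∨
    ∃ g₁ g₂, g = g₁ * g₂ ∧
      ((u = g₁ ∧ v = g₂ ∧ c = fun x => x) ∨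
        (∃ a, u = a * g₁ ∧ v = g₂ ∧ c = fun x => a * x) ∨
        (∃ b, u = g₁ ∧ v = g₂ * b ∧ c = fun x => x * b) ∨
        ∃ a b, u = a * g₁ ∧ v = g₂ * b ∧ c = fun x => a * x * b) := by
  induction hc with
  | id => exact fun {u v} h => .inr (.inr ⟨u, v, h.symm, .inl ⟨rfl, rfl, rfl⟩⟩)
  | bracket ω hc ih => exact fun {u v} h => absurd h.symm (bracket_ne_mul _ _ _ _)
  | @mul_left a c hc ih =>
    intro u v h
    rcases mul_eq_mul_cases h with ⟨rfl, rfl⟩ | ⟨t, rfl, h'⟩ | ⟨t, rfl, rfl⟩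
    · exact .inr (.inl ⟨c, hc, rfl, rfl⟩)
    · rcases ih h'.symm with ⟨c', hc', rfl, rfl⟩ | ⟨c', hc', rfl, rfl⟩ | ⟨g₁, g₂, rfl,
        ⟨rfl, rfl, rfl⟩ | ⟨d, rfl, rfl, rfl⟩ | ⟨b, rfl, rfl, rfl⟩ | ⟨d, b, rfl, rfl, rfl⟩⟩
      · exact .inl ⟨_, hc'.mul_left a, rfl, by simp only [mul_assoc]⟩
      · exact .inr (.inl ⟨c', hc', rfl, by simp only [mul_assoc]⟩)
      · exact .inr (.inr ⟨_, _, rfl, .inr (.inl ⟨a, rfl, rfl, rfl⟩)⟩)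
      · exact .inr (.inr ⟨_, _, rfl, .inr (.inl ⟨a * d, by simp only [mul_assoc], rfl,
          by simp only [mul_assoc]⟩)⟩)
      · exact .inr (.inr ⟨_, _, rfl, .inr (.inr (.inr ⟨a, b, rfl, rfl,
          by simp only [mul_assoc]⟩))⟩)
      · exact .inr (.inr ⟨_, _, rfl, .inr (.inr (.inr ⟨a * d, b, by simp only [mul_assoc], rfl,
          by simp only [mul_assoc]⟩))⟩)
    · exact .inr (.inl ⟨_, hc.mul_left t, rfl, by simp only [mul_assoc]⟩)
  | @mul_right b c hc ih =>
    intro u v h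
    rcases mul_eq_mul_cases h with ⟨rfl, rfl⟩ | ⟨t, rfl, rfl⟩ | ⟨t, h', rfl⟩
    · exact .inl ⟨c, hc, rfl, rfl⟩
    · exact .inl ⟨_, hc.mul_right t, rfl, by simp only [mul_assoc]⟩
    · rcases ih h'.symm with ⟨c', hc', rfl, rfl⟩ | ⟨c', hc', rfl, rfl⟩ | ⟨g₁, g₂, rfl,
        ⟨rfl, rfl, rfl⟩ | ⟨d, rfl, rfl, rfl⟩ | ⟨e, rfl, rfl, rfl⟩ | ⟨d, e, rfl, rfl, rfl⟩⟩
      · exact .inl ⟨c', hc', rfl, by simp only [mul_assoc]⟩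
      · exact .inr (.inl ⟨_, hc'.mul_right b, rfl, by simp only [mul_assoc]⟩)
      · exact .inr (.inr ⟨_, _, rfl, .inr (.inr (.inl ⟨b, rfl, rfl, rfl⟩))⟩)
      · exact .inr (.inr ⟨_, _, rfl, .inr (.inr (.inr ⟨d, b, rfl, rfl, rfl⟩))⟩)
      · exact .inr (.inr ⟨_, _, rfl, .inr (.inr (.inl ⟨e * b, rfl, by simp only [mul_assoc],
          by simp only [mul_assoc]⟩))⟩)
      · exact .inr (.inr ⟨_, _, rfl, .inr (.inr (.inr ⟨d, e * b, rfl, by simp only [mul_assoc],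
          by simp only [mul_assoc]⟩))⟩)

end OpWord

mutual

theorem OpLetter.isContext_subst {Ω Z : Type*} :
    ∀ a : OpLetter Ω (Option Z), a.starCount = 1 →
      OpWord.IsContext fun u : OpWord Ω Z => a.subst fun z => z.elim u OpWord.var
  | .var none, _ => by simpa [OpLetter.subst] using OpWord.IsContext.id
  | .var (some _), h => by simp [OpLetter.starCount] at h
  | .op ω w, h => by
      rw [OpLetter.starCount] at h
      simpa only [OpLetter.subst] using (OpWord.isContext_subst w h).bracket ω

theorem OpWord.isContext_subst {Ω Z : Type*} :
    ∀ w : OpWord Ω (Option Z), w.starCount = 1 →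
      OpWord.IsContext fun u : OpWord Ω Z => w.subst fun z => z.elim u OpWord.var
  | .single a, h => by
      rw [OpWord.starCount] at h
      simpa only [OpWord.subst] using OpLetter.isContext_subst a h
  | .cons a w, h => by
      rw [OpWord.starCount] at h
      simp only [OpWord.subst]
      rcases Nat.eq_zero_or_pos a.starCount with ha | ha
      · have hw := OpWord.isContext_subst w (by omega)
        have (u v : OpWord Ω Z) := OpLetter.subst_congr_of_starCount_eq_zero u v a ha
        by_cases hZ : Nonempty (OpWord Ω Z)
        · obtain ⟨v⟩ := hZ
          simpa only [this _ v] using hw.mul_left _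
        · convert OpWord.IsContext.id using 1
          ext u
          exact absurd ⟨u⟩ hZ
      · have hw := OpLetter.isContext_subst a (by omega)
        have (u v : OpWord Ω Z) :=
          OpWord.subst_congr_of_starCount_eq_zero u v w (by omega)
        by_cases hZ : Nonempty (OpWord Ω Z)
        · obtain ⟨v⟩ := hZ
          simpa only [this _ v] using hw.mul_right _
        · convert OpWord.IsContext.id using 1
          ext u
          exact absurd ⟨u⟩ hZ

end

theorem StarWord.isContext_plug {Ω Z : Type*} (q : StarWord Ω Z) : OpWord.IsContext q.plug :=
  OpWord.isContext_subst q.1 q.2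

mutual

theorem OpLetter.degZ_pos {Ω Z : Type*} : ∀ a : OpLetter Ω Z, 0 < a.degZ
  | .var _ => by simp [OpLetter.degZ]
  | .op _ u => by rw [OpLetter.degZ]; exact OpWord.degZ_pos u

theorem OpWord.degZ_pos {Ω Z : Type*} : ∀ u : OpWord Ω Z, 0 < u.degZ
  | .single a => by rw [OpWord.degZ]; exact OpLetter.degZ_pos a
  | .cons a u => by rw [OpWord.degZ]; exact Nat.add_pos_left (OpLetter.degZ_pos a) _

end

mutual

theorem OpLetter.degGPIn_eq_add {Z : Type*} {m n : ℕ} (h : m ≤ n) :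
    ∀ a : OpLetter PDOp Z, a.degZ ≤ m → a.degGPIn n = a.degGPIn m + a.degP * (n - m)
  | .var _, _ => by simp [OpLetter.degGPIn, OpLetter.degP]
  | .op .D u, hu => by
      simpa only [OpLetter.degGPIn, OpLetter.degP] using OpWord.degGPIn_eq_add h u hu
  | .op .P u, hu => by
      rw [OpLetter.degZ] at hu
      simp only [OpLetter.degGPIn, OpLetter.degP, OpWord.degGPIn_eq_add h u hu, add_mul]
      omega

theorem OpWord.degGPIn_eq_add {Z : Type*} {m n : ℕ} (h : m ≤ n) :
    ∀ u : OpWord PDOp Z, u.degZ ≤ m → u.degGPIn n = u.degGPIn m + u.degP * (n - m)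
  | .single a, ha => by
      simpa only [OpWord.degGPIn, OpWord.degP] using OpLetter.degGPIn_eq_add h a ha
  | .cons a u, hu => by
      rw [OpWord.degZ] at hu
      simp only [OpWord.degGPIn, OpWord.degP, OpLetter.degGPIn_eq_add h a (by omega),
        OpWord.degGPIn_eq_add h u (by omega), add_mul]
      omega

end

namespace OpWord

variable {Z : Type*}

@[simp] theorem degZ_mul {Ω : Type*} :
    ∀ u v : OpWord Ω Z, (u * v).degZ = u.degZ + v.degZ
  | single a, v => by simp [single_mul, degZ]
  | cons a u, v => by simp [cons_mul, degZ, degZ_mul u v, add_assoc]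

@[simp] theorem degED_mul : ∀ u v : OpWord PDOp Z, (u * v).degED = u.degED + v.degED
  | single a, v => by simp [single_mul, degED]
  | cons a u, v => by simp [cons_mul, degED, degED_mul u v, add_assoc]

@[simp] theorem degD_mul : ∀ u v : OpWord PDOp Z, (u * v).degD = u.degD + v.degD
  | single a, v => by simp [single_mul, degD]
  | cons a u, v => by simp [cons_mul, degD, degD_mul u v, add_assoc]

@[simp] theorem degP_mul : ∀ u v : OpWord PDOp Z, (u * v).degP = u.degP + v.degP
  | single a, v => by simp [single_mul, degP]
  | cons a u, v => by simp [cons_mul, degP, degP_mul u v, add_assoc]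

@[simp] theorem degGPIn_mul (n : ℕ) :
    ∀ u v : OpWord PDOp Z, (u * v).degGPIn n = u.degGPIn n + v.degGPIn n
  | single a, v => by simp [single_mul, degGPIn]
  | cons a u, v => by simp [cons_mul, degGPIn, degGPIn_mul n u v, add_assoc]

section bracket

variable (u : OpWord PDOp Z)

@[simp] theorem degZ_bracket (ω : PDOp) : (bracket ω u).degZ = u.degZ := by
  simp [bracket, degZ, OpLetter.degZ]

@[simp] theorem degED_bracket_D : (bracket .D u).degED = u.degED + (u.degZ - 1) := by
  simp [bracket, degED, OpLetter.degED]

@[simp] theorem degED_bracket_P : (bracket .P u).degED = u.degED := by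
  simp [bracket, degED, OpLetter.degED]

@[simp] theorem degD_bracket_D : (bracket .D u).degD = u.degD + 1 := by
  simp [bracket, degD, OpLetter.degD]

@[simp] theorem degD_bracket_P : (bracket .P u).degD = u.degD := by
  simp [bracket, degD, OpLetter.degD]

@[simp] theorem degP_bracket_D : (bracket .D u).degP = u.degP := by
  simp [bracket, degP, OpLetter.degP]

@[simp] theorem degP_bracket_P : (bracket .P u).degP = u.degP + 1 := by
  simp [bracket, degP, OpLetter.degP]

@[simp] theorem degGPIn_bracket_D (n : ℕ) : (bracket .D u).degGPIn n = u.degGPIn n := by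
  simp [bracket, degGPIn, OpLetter.degGPIn]

@[simp] theorem degGPIn_bracket_P (n : ℕ) :
    (bracket .P u).degGPIn n = u.degGPIn n + (n - u.degZ) := by
  simp [bracket, degGPIn, OpLetter.degGPIn]

@[simp] theorem degGP_bracket (ω : PDOp) : (bracket ω u).degGP = u.degGP := by
  cases ω <;> simp [degGP]

end bracket

theorem degGP_mul (u v : OpWord PDOp Z) :
    (u * v).degGP = u.degGP + u.degP * v.degZ + (v.degGP + v.degP * u.degZ) := by
  simp [degGP, u.degGPIn_eq_add (Nat.le_add_right u.degZ v.degZ) le_rfl,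
    v.degGPIn_eq_add (Nat.le_add_left v.degZ u.degZ) le_rfl]

end OpWord

/-! ### The degree-lexicographic order -/

section dlex

variable {Z : Type*}

theorem OpWord.breadth_le_of_dlexLT [LT Z] :
    ∀ {u v : OpWord PDOp Z}, u.dlexLT v → u.breadth ≤ v.breadth
  | .single _, .single _, _ => le_rfl
  | .single _, .cons _ _, _ => by simp
  | .cons _ _, .single _, h => by simp [OpWord.dlexLT] at h
  | .cons _ _, .cons _ _, h => by
      rw [OpWord.dlexLT] at h
      simp only [OpWord.breadth_cons]
      omega

theorem OpWord.dlexLT_cons_iff [LT Z] {a b : OpLetter PDOp Z} {u v : OpWord PDOp Z} :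
    (OpWord.cons a u).dlexLT (.cons b v) ↔ u.breadth < v.breadth ∨
      (u.breadth = v.breadth ∧ (a.dlexLT b ∨ (a = b ∧ u.dlexLT v))) := by
  rw [OpWord.dlexLT]

theorem OpWord.dlexLT_cons_left [LT Z] (a : OpLetter PDOp Z) {u v : OpWord PDOp Z}
    (h : u.dlexLT v) : (OpWord.cons a u).dlexLT (.cons a v) := by
  rw [OpWord.dlexLT_cons_iff]
  rcases (OpWord.breadth_le_of_dlexLT h).lt_or_eq with h' | h'
  · exact .inl h'
  · exact .inr ⟨h', .inr ⟨rfl, h⟩⟩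

theorem OpWord.dlexLT_mul_left [LT Z] {u v : OpWord PDOp Z} (h : u.dlexLT v) :
    ∀ a : OpWord PDOp Z, (a * u).dlexLT (a * v)
  | .single a => OpWord.dlexLT_cons_left a h
  | .cons a w => OpWord.dlexLT_cons_left a (OpWord.dlexLT_mul_left h w)

theorem OpWord.dlexLT_mul_right [LT Z] (b : OpWord PDOp Z) :
    ∀ {u v : OpWord PDOp Z}, u.dlexLT v → (u * b).dlexLT (v * b)
  | .single _, .single _, h => by
      rw [OpWord.dlexLT] at h
      exact OpWord.dlexLT_cons_iff.2 (.inr ⟨rfl, .inl h⟩)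
  | .single _, .cons _ v, _ => by
      rw [OpWord.single_mul, OpWord.cons_mul, OpWord.dlexLT_cons_iff, OpWord.breadth_mul]
      exact .inl (Nat.lt_add_of_pos_left v.breadth_pos)
  | .cons _ _, .single _, h => by simp [OpWord.dlexLT] at h
  | .cons _ u, .cons _ v, h => by
      rw [OpWord.dlexLT_cons_iff] at h
      rw [OpWord.cons_mul, OpWord.cons_mul, OpWord.dlexLT_cons_iff, OpWord.breadth_mul,
        OpWord.breadth_mul, add_lt_add_iff_right, add_left_inj]
      rcases h with h | ⟨h, h' | ⟨h', h''⟩⟩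
      · exact .inl h
      · exact .inr ⟨h, .inl h'⟩
      · exact .inr ⟨h, .inr ⟨h', OpWord.dlexLT_mul_right b h''⟩⟩

theorem OpWord.dlexLT_bracket [LT Z] (ω : PDOp) {u v : OpWord PDOp Z} (h : u.dlexLT v) :
    (OpWord.bracket ω u).dlexLT (.bracket ω v) := by
  cases ω <;> simpa [OpWord.bracket, OpWord.dlexLT, OpLetter.dlexLT] using h

theorem OpWord.bracket_P_dlexLT_bracket_D [LT Z] (u v : OpWord PDOp Z) :
    (OpWord.bracket .P u).dlexLT (.bracket .D v) := by
  simp [OpWord.bracket, OpWord.dlexLT, OpLetter.dlexLT]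

mutual

theorem OpLetter.dlexLT_irrefl [Preorder Z] : ∀ a : OpLetter PDOp Z, ¬ a.dlexLT a
  | .var z => by simp [OpLetter.dlexLT]
  | .op .D u => by simpa [OpLetter.dlexLT] using OpWord.dlexLT_irrefl u
  | .op .P u => by simpa [OpLetter.dlexLT] using OpWord.dlexLT_irrefl u

theorem OpWord.dlexLT_irrefl [Preorder Z] : ∀ u : OpWord PDOp Z, ¬ u.dlexLT u
  | .single a => by simpa [OpWord.dlexLT] using OpLetter.dlexLT_irrefl a
  | .cons a u => by
      simp [OpWord.dlexLT, OpLetter.dlexLT_irrefl a, OpWord.dlexLT_irrefl u]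

end

mutual

theorem OpLetter.dlexLT_trans [Preorder Z] :
    ∀ {a b c : OpLetter PDOp Z}, a.dlexLT b → b.dlexLT c → a.dlexLT c
  | .var _, .var _, .var _, h, h' => by
      simp only [OpLetter.dlexLT] at *
      exact h.trans h'
  | .var _, _, .op _ _, _, _ => by simp [OpLetter.dlexLT]
  | .var _, .op _ _, .var _, _, h' => by simp [OpLetter.dlexLT] at h'
  | .op _ _, .var _, _, h, _ => by simp [OpLetter.dlexLT] at h
  | .op _ _, .op _ _, .var _, _, h' => by simp [OpLetter.dlexLT] at h'
  | .op .P _, .op .P _, .op .P _, h, h' => by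
      simp only [OpLetter.dlexLT] at *
      exact OpWord.dlexLT_trans h h'
  | .op .D _, .op .D _, .op .D _, h, h' => by
      simp only [OpLetter.dlexLT] at *
      exact OpWord.dlexLT_trans h h'
  | .op .P _, _, .op .D _, _, _ => by simp [OpLetter.dlexLT]
  | .op .D _, .op .P _, _, h, _ => by simp [OpLetter.dlexLT] at h
  | _, .op .D _, .op .P _, _, h' => by simp [OpLetter.dlexLT] at h'

theorem OpWord.dlexLT_trans [Preorder Z] :
    ∀ {u v w : OpWord PDOp Z}, u.dlexLT v → v.dlexLT w → u.dlexLT w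
  | .single _, .single _, .single _, h, h' => by
      simp only [OpWord.dlexLT] at *
      exact OpLetter.dlexLT_trans h h'
  | .single _, _, .cons _ _, _, _ => by simp [OpWord.dlexLT]
  | .cons _ _, .single _, _, h, _ => by simp [OpWord.dlexLT] at h
  | _, .cons _ _, .single _, _, h' => by simp [OpWord.dlexLT] at h'
  | .cons a u, .cons b v, .cons c w, h, h' => by
      rw [OpWord.dlexLT_cons_iff] at *
      rcases h with h | ⟨h, h₁⟩
      · exact .inl (by omega)
      rcases h' with h' | ⟨h', h₂⟩
      · exact .inl (by omega)
      refine .inr ⟨h.trans h', ?_⟩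
      rcases h₁ with h₁ | ⟨rfl, h₁⟩
      · rcases h₂ with h₂ | ⟨rfl, h₂⟩
        · exact .inl (OpLetter.dlexLT_trans h₁ h₂)
        · exact .inl h₁
      · rcases h₂ with h₂ | ⟨rfl, h₂⟩
        · exact .inl h₂
        · exact .inr ⟨rfl, OpWord.dlexLT_trans h₁ h₂⟩

end

mutual

theorem OpLetter.dlexLT_trichotomous [LinearOrder Z] :
    ∀ a b : OpLetter PDOp Z, a.dlexLT b ∨ a = b ∨ b.dlexLT a
  | .var z, .var z' => by simpa [OpLetter.dlexLT] using lt_trichotomy z z'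
  | .var _, .op _ _ => by simp [OpLetter.dlexLT]
  | .op _ _, .var _ => by simp [OpLetter.dlexLT]
  | .op .P u, .op .P v => by simpa [OpLetter.dlexLT] using OpWord.dlexLT_trichotomous u v
  | .op .D u, .op .D v => by simpa [OpLetter.dlexLT] using OpWord.dlexLT_trichotomous u v
  | .op .P _, .op .D _ => by simp [OpLetter.dlexLT]
  | .op .D _, .op .P _ => by simp [OpLetter.dlexLT]

theorem OpWord.dlexLT_trichotomous [LinearOrder Z] :
    ∀ u v : OpWord PDOp Z, u.dlexLT v ∨ u = v ∨ v.dlexLT u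
  | .single a, .single b => by simpa [OpWord.dlexLT] using OpLetter.dlexLT_trichotomous a b
  | .single _, .cons _ _ => by simp [OpWord.dlexLT]
  | .cons _ _, .single _ => by simp [OpWord.dlexLT]
  | .cons a u, .cons b v => by
      simp only [OpWord.dlexLT_cons_iff, OpWord.cons.injEq]
      rcases lt_trichotomy u.breadth v.breadth with h | h | h
      · exact .inl (.inl h)
      · rcases OpLetter.dlexLT_trichotomous a b with h' | rfl | h'
        · exact .inl (.inr ⟨h, .inl h'⟩)
        · rcases OpWord.dlexLT_trichotomous u v with h' | rfl | h'
          · exact .inl (.inr ⟨h, .inr ⟨rfl, h'⟩⟩)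
          · exact .inr (.inl ⟨rfl, rfl⟩)
          · exact .inr (.inr (.inr ⟨h.symm, .inr ⟨rfl, h'⟩⟩))
        · exact .inr (.inr (.inr ⟨h.symm, .inl h'⟩))
      · exact .inr (.inr (.inl h))

end

end dlex

/-! ### Well-foundedness -/

section wf

variable {Z : Type*}

/-- The number of generators and brackets in a word. -/
def OpWord.size (u : OpWord PDOp Z) : ℕ := u.degZ + u.degD + u.degP

/-- The number of generators and brackets in a letter. -/
def OpLetter.size (a : OpLetter PDOp Z) : ℕ := a.degZ + a.degD + a.degP

theorem OpLetter.size_op (ω : PDOp) (u : OpWord PDOp Z) : (OpLetter.op ω u).size = u.size + 1 := by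
  cases ω <;>
    simp only [OpLetter.size, OpWord.size, OpLetter.degZ, OpLetter.degD, OpLetter.degP] <;> omega

theorem OpWord.size_single (a : OpLetter PDOp Z) : (OpWord.single a).size = a.size := by
  simp only [OpLetter.size, OpWord.size, OpWord.degZ, OpWord.degD, OpWord.degP]

theorem OpWord.size_cons (a : OpLetter PDOp Z) (u : OpWord PDOp Z) :
    (OpWord.cons a u).size = a.size + u.size := by
  simp only [OpLetter.size, OpWord.size, OpWord.degZ, OpWord.degD, OpWord.degP]
  omega

variable [LinearOrder Z]

/-- The degree-lexicographic order on the words of size at most `N`. -/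
def OpWord.dlexLTBdd (N : ℕ) (u v : OpWord PDOp Z) : Prop :=
  u.dlexLT v ∧ u.size ≤ N

/-- The degree-lexicographic order on the letters of size at most `N`. -/
def OpLetter.dlexLTBdd (N : ℕ) (a b : OpLetter PDOp Z) : Prop :=
  a.dlexLT b ∧ a.size ≤ N

theorem OpLetter.acc_var [WellFoundedLT Z] (N : ℕ) (z : Z) :
    Acc (OpLetter.dlexLTBdd N) (.var z) := by
  induction z using WellFoundedLT.induction with
  | ind z ih =>
    refine ⟨_, ?_⟩
    rintro (z' | _) ⟨h, -⟩
    · exact ih z' (by simpa [OpLetter.dlexLT] using h)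
    · simp [OpLetter.dlexLT] at h

theorem OpLetter.acc_op_P [WellFoundedLT Z] (N : ℕ)
    (hw : ∀ u : OpWord PDOp Z, u.size ≤ N → Acc (OpWord.dlexLTBdd N) u)
    (u : OpWord PDOp Z) (hu : u.size ≤ N) : Acc (OpLetter.dlexLTBdd (N + 1)) (.op .P u) := by
  induction hw u hu with
  | intro u _ ih =>
    refine ⟨_, ?_⟩
    rintro (z' | ⟨_ | _, v⟩) ⟨h, h'⟩
    · exact OpLetter.acc_var _ z'
    · simp [OpLetter.dlexLT] at h
    · rw [OpLetter.size_op] at h'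
      exact ih v ⟨by simpa [OpLetter.dlexLT] using h, by omega⟩ (by omega)

theorem OpLetter.acc_op_D [WellFoundedLT Z] (N : ℕ)
    (hw : ∀ u : OpWord PDOp Z, u.size ≤ N → Acc (OpWord.dlexLTBdd N) u)
    (u : OpWord PDOp Z) (hu : u.size ≤ N) : Acc (OpLetter.dlexLTBdd (N + 1)) (.op .D u) := by
  induction hw u hu with
  | intro u _ ih =>
    refine ⟨_, ?_⟩
    rintro (z' | ⟨_ | _, v⟩) ⟨h, h'⟩ <;> try rw [OpLetter.size_op] at h'
    · exact OpLetter.acc_var _ z'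
    · exact ih v ⟨by simpa [OpLetter.dlexLT] using h, by omega⟩ (by omega)
    · exact OpLetter.acc_op_P N hw v (by omega)

theorem OpWord.acc_of_acc_letter (N : ℕ)
    (hl : ∀ a : OpLetter PDOp Z, a.size ≤ N → Acc (OpLetter.dlexLTBdd N) a) (n : ℕ) :
    ∀ u : OpWord PDOp Z, u.breadth ≤ n → u.size ≤ N → Acc (OpWord.dlexLTBdd N) u := by
  have hs (a : OpLetter PDOp Z) (ha : a.size ≤ N) : Acc (OpWord.dlexLTBdd N) (.single a) := by
    induction hl a ha with
    | intro a _ ih =>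
      refine ⟨_, ?_⟩
      rintro (b | _) ⟨h, h'⟩
      · rw [OpWord.size_single] at h'
        exact ih b ⟨by simpa [OpWord.dlexLT] using h, h'⟩ h'
      · simp [OpWord.dlexLT] at h
  induction n with
  | zero => exact fun u hu => absurd u.breadth_pos (by omega)
  | succ n ihn =>
    rintro (a | ⟨a, u⟩) hn hN
    · exact hs a (by rwa [OpWord.size_single] at hN)
    rw [OpWord.size_cons] at hN
    rw [OpWord.breadth_cons] at hn
    have ha := hl a (by omega)
    induction ha generalizing u with
    | intro a _ iha =>
      have hu := ihn u (by omega) (by omega)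
      induction hu with
      | intro u _ ihu =>
        refine ⟨_, ?_⟩
        rintro (b | ⟨b, v⟩) ⟨h, h'⟩
        · exact hs b (by rwa [OpWord.size_single] at h')
        have h'' := h'
        rw [OpWord.size_cons] at h'
        rw [OpWord.dlexLT_cons_iff] at h
        rcases h with h | ⟨h, h₁ | ⟨rfl, h₁⟩⟩
        · exact ihn _ (by rw [OpWord.breadth_cons]; omega) h''
        · exact iha b ⟨h₁, by omega⟩ v (by omega) (by omega)
        · exact ihu v ⟨h₁, by omega⟩ (by omega) (by omega)

theorem OpWord.acc_dlexLTBdd [WellFoundedLT Z] (N : ℕ) :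
    ∀ u : OpWord PDOp Z, u.size ≤ N → Acc (OpWord.dlexLTBdd N) u := by
  induction N with
  | zero =>
    intro u hu
    have := u.degZ_pos
    rw [OpWord.size] at hu
    omega
  | succ N ih =>
    refine fun u => OpWord.acc_of_acc_letter _ ?_ u.breadth u le_rfl
    rintro (z | ⟨_ | _, u⟩) hu
    · exact OpLetter.acc_var _ z
    · rw [OpLetter.size_op] at hu
      exact OpLetter.acc_op_D N ih u (by omega)
    · rw [OpLetter.size_op] at hu
      exact OpLetter.acc_op_P N ih u (by omega)

theorem OpWord.wellFounded_dlexLT_of_size_eq [WellFoundedLT Z] :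
    WellFounded fun u v : OpWord PDOp Z => u.dlexLT v ∧ u.size = v.size := by
  refine ⟨fun u => ?_⟩
  have h := OpWord.acc_dlexLTBdd u.size u le_rfl
  generalize hN : u.size = N at h
  induction h with
  | intro u _ ih => exact ⟨_, fun v hv => ih v ⟨hv.1, by omega⟩ (by omega)⟩

end wf

/-! ### The orders `≤_zdp` and `≤'_zdp` -/

namespace OpWord

variable {Z : Type*} [LinearOrder Z]

section

variable (f : OpWord PDOp Z → ℕ ×ₗ ℕ ×ₗ ℕ ×ₗ ℕ ×ₗ ℕ)

theorem isWellLinearOrder_of_degrees [WellFoundedLT Z] (le : OpWord PDOp Z → OpWord PDOp Z → Prop)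
    (hle : ∀ u v, le u v ↔ f u < f v ∨ f u = f v ∧ dlexLE u v)
    (hf : ∀ u v, f u = f v → u.size = v.size) : IsWellLinearOrder le := by
  have hlt : ∀ u v, le u v ∧ u ≠ v → f u < f v ∨ f u = f v ∧ dlexLT u v := by
    rintro u v ⟨h, hne⟩
    rw [hle, dlexLE] at h
    tauto
  refine ⟨{ refl := fun u => (hle u u).2 (.inr ⟨rfl, .inr rfl⟩)
            trans := fun u v w h h' => ?_
            antisymm := fun u v h h' => ?_
            total := fun u v => ?_ }, ?_⟩
  · by_cases huv : u = v
    · rwa [huv]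
    by_cases hvw : v = w
    · rwa [← hvw]
    rw [hle, dlexLE]
    rcases hlt _ _ ⟨h, huv⟩ with h | ⟨h, h₁⟩ <;> rcases hlt _ _ ⟨h', hvw⟩ with h' | ⟨h', h₂⟩
    · exact .inl (h.trans h')
    · exact .inl (h' ▸ h)
    · exact .inl (h ▸ h')
    · exact .inr ⟨h.trans h', .inl (dlexLT_trans h₁ h₂)⟩
  · by_contra hne
    rcases hlt _ _ ⟨h, hne⟩ with h | ⟨h, h₁⟩ <;>
      rcases hlt _ _ ⟨h', Ne.symm hne⟩ with h' | ⟨h', h₂⟩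
    · exact lt_asymm h h'
    · exact h.ne h'.symm
    · exact h'.ne h.symm
    · exact dlexLT_irrefl _ (dlexLT_trans h₁ h₂)
  · rw [hle, hle, dlexLE, dlexLE]
    rcases lt_trichotomy (f u) (f v) with h | h | h
    · exact .inl (.inl h)
    · rcases dlexLT_trichotomous u v with h' | h' | h'
      · exact .inl (.inr ⟨h, .inl h'⟩)
      · exact .inl (.inr ⟨h, .inr h'⟩)
      · exact .inr (.inr ⟨h.symm, .inl h'⟩)
    · exact .inr (.inl h)
  · have hwf := (wellFounded_lt (α := ℕ ×ₗ ℕ ×ₗ ℕ ×ₗ ℕ ×ₗ ℕ)).prod_lex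
      (wellFounded_dlexLT_of_size_eq (Z := Z))
    refine Subrelation.wf ?_ (InvImage.wf (fun u => (f u, u)) hwf)
    intro u v h
    rw [InvImage, Prod.lex_def]
    rcases hlt u v h with h | ⟨h, h'⟩
    · exact .inl h
    · exact .inr ⟨h, h', hf _ _ h⟩

end

theorem isWellLinearOrder_zdpLE [WellFoundedLT Z] : IsWellLinearOrder (zdpLE (Z := Z)) := by
  refine isWellLinearOrder_of_degrees
    (fun u => toLex (u.degZ, toLex (u.degED, toLex (u.degD, toLex (u.degGP, u.degP))))) _
    (fun u v => ?_) (fun u v h => ?_)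
  · simp only [zdpLE, Prod.Lex.toLex_lt_toLex, toLex_inj, Prod.mk.injEq]
    tauto
  · simp only [toLex_inj, Prod.mk.injEq] at h
    simp only [size, h]

theorem isWellLinearOrder_zdpLE' [WellFoundedLT Z] : IsWellLinearOrder (zdpLE' (Z := Z)) := by
  refine isWellLinearOrder_of_degrees
    (fun u => toLex (u.degZ, toLex (u.degED, toLex (u.degD, toLex (u.degP, u.degGP))))) _
    (fun u v => ?_) (fun u v h => ?_)
  · simp only [zdpLE', Prod.Lex.toLex_lt_toLex, toLex_inj, Prod.mk.injEq]
    tauto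
  · simp only [toLex_inj, Prod.mk.injEq] at h
    simp only [size, h]

/-- The strict part of `≤'_zdp`. -/
def zdpLT' (u v : OpWord PDOp Z) : Prop :=
  u.degZ < v.degZ ∨ (u.degZ = v.degZ ∧ (u.degED < v.degED ∨ (u.degED = v.degED ∧
    (u.degD < v.degD ∨ (u.degD = v.degD ∧ (u.degP < v.degP ∨ (u.degP = v.degP ∧
      (u.degGP < v.degGP ∨ (u.degGP = v.degGP ∧ dlexLT u v)))))))))

theorem zdpLT'_iff {u v : OpWord PDOp Z} : zdpLT' u v ↔ zdpLE' u v ∧ u ≠ v := by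
  by_cases h : u = v
  · subst h
    simp [zdpLT', dlexLT_irrefl]
  · simp only [zdpLT', zdpLE', dlexLE, h, or_false, ne_eq, not_false_eq_true, and_true]
    tauto

theorem zdpLT'.mul_left {u v : OpWord PDOp Z} (h : zdpLT' u v) (a : OpWord PDOp Z) :
    zdpLT' (a * u) (a * v) := by
  unfold zdpLT' at *
  simp only [degZ_mul, degED_mul, degD_mul, degP_mul, degGP_mul, add_lt_add_iff_left,
    add_right_inj]
  rcases h with h | ⟨h, h | ⟨h₁, h | ⟨h₂, h | ⟨h₃, h | ⟨h₄, h₅⟩⟩⟩⟩⟩ <;>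
    simp_all [dlexLT_mul_left]

theorem zdpLT'.mul_right {u v : OpWord PDOp Z} (h : zdpLT' u v) (b : OpWord PDOp Z) :
    zdpLT' (u * b) (v * b) := by
  unfold zdpLT' at *
  simp only [degZ_mul, degED_mul, degD_mul, degP_mul, degGP_mul, add_lt_add_iff_right,
    add_left_inj]
  rcases h with h | ⟨h, h | ⟨h₁, h | ⟨h₂, h | ⟨h₃, h | ⟨h₄, h₅⟩⟩⟩⟩⟩ <;>
    simp_all [dlexLT_mul_right]

theorem zdpLT'.bracket {u v : OpWord PDOp Z} (h : zdpLT' u v) (ω : PDOp) :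
    zdpLT' (OpWord.bracket ω u) (OpWord.bracket ω v) := by
  unfold zdpLT' at *
  cases ω <;>
  rcases h with h | ⟨h, h | ⟨h₁, h | ⟨h₂, h | ⟨h₃, h | ⟨h₄, h₅⟩⟩⟩⟩⟩ <;>
    simp_all [dlexLT_bracket]

theorem isMonomialOrder_zdpLE' [WellFoundedLT Z] : IsMonomialOrder (zdpLE' (Z := Z)) := by
  refine ⟨isWellLinearOrder_zdpLE', fun q u v h hne => ?_⟩
  rw [← zdpLT'_iff]
  replace h := zdpLT'_iff.2 ⟨h, hne⟩
  have hq := q.isContext_plug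
  generalize q.plug = c at hq
  induction hq with
  | id => exact h
  | mul_left a _ ih => exact ih.mul_left a
  | mul_right b _ ih => exact ih.mul_right b
  | bracket ω _ ih => exact ih.bracket ω

/-- A strict order contained in both `≤_zdp` and `≤'_zdp` and preserved by all contexts. -/
def StableLT (u v : OpWord PDOp Z) : Prop :=
  u.degZ = v.degZ ∧ (u.degED < v.degED ∨ (u.degED = v.degED ∧
    (u.degD < v.degD ∨ (u.degD = v.degD ∧ u.degGP ≤ v.degGP ∧ u.degP ≤ v.degP ∧
      (u.degGP < v.degGP ∨ u.degP < v.degP ∨ dlexLT u v)))))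

theorem StableLT.zdpLE {u v : OpWord PDOp Z} (h : StableLT u v) : zdpLE u v := by
  obtain ⟨h, h' | ⟨h₁, h' | ⟨h₂, h₃, h₄, h₅⟩⟩⟩ := h
  · exact .inr (.inl ⟨h, h'⟩)
  · exact .inr (.inr (.inl ⟨h, h₁, h'⟩))
  · rcases h₃.lt_or_eq with h₃ | h₃
    · exact .inr (.inr (.inr (.inl ⟨h, h₁, h₂, h₃⟩)))
    rcases h₄.lt_or_eq with h₄ | h₄
    · exact .inr (.inr (.inr (.inr (.inl ⟨h, h₁, h₂, h₃, h₄⟩))))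
    · exact .inr (.inr (.inr (.inr (.inr ⟨h, h₁, h₂, h₃, h₄,
        .inl ((h₅.resolve_left h₃.not_lt).resolve_left h₄.not_lt)⟩))))

theorem StableLT.zdpLE' {u v : OpWord PDOp Z} (h : StableLT u v) : zdpLE' u v := by
  obtain ⟨h, h' | ⟨h₁, h' | ⟨h₂, h₃, h₄, h₅⟩⟩⟩ := h
  · exact .inr (.inl ⟨h, h'⟩)
  · exact .inr (.inr (.inl ⟨h, h₁, h'⟩))
  · rcases h₄.lt_or_eq with h₄ | h₄
    · exact .inr (.inr (.inr (.inl ⟨h, h₁, h₂, h₄⟩)))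
    rcases h₃.lt_or_eq with h₃ | h₃
    · exact .inr (.inr (.inr (.inr (.inl ⟨h, h₁, h₂, h₄, h₃⟩))))
    · exact .inr (.inr (.inr (.inr (.inr ⟨h, h₁, h₂, h₄, h₃,
        .inl ((h₅.resolve_left h₃.not_lt).resolve_left h₄.not_lt)⟩))))

theorem StableLT.ne {u v : OpWord PDOp Z} (h : StableLT u v) : u ≠ v := by
  rintro rfl
  simp [StableLT, dlexLT_irrefl] at h

theorem StableLT.trans {u v w : OpWord PDOp Z} (h : StableLT u v) (h' : StableLT v w) :
    StableLT u w := by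
  obtain ⟨h, hu⟩ := h
  obtain ⟨h', hv⟩ := h'
  refine ⟨h.trans h', ?_⟩
  rcases hu with hu | ⟨hu₁, hu | ⟨hu₂, hu₃, hu₄, hu₅⟩⟩ <;>
    rcases hv with hv | ⟨hv₁, hv | ⟨hv₂, hv₃, hv₄, hv₅⟩⟩ <;> try omega
  refine .inr ⟨hu₁.trans hv₁, .inr ⟨hu₂.trans hv₂, hu₃.trans hv₃, hu₄.trans hv₄, ?_⟩⟩
  rcases hu₅ with hu₅ | hu₅ | hu₅ <;> rcases hv₅ with hv₅ | hv₅ | hv₅ <;> try omega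
  exact .inr (.inr (dlexLT_trans hu₅ hv₅))

theorem StableLT.mul_left {u v : OpWord PDOp Z} (h : StableLT u v) (a : OpWord PDOp Z) :
    StableLT (a * u) (a * v) := by
  obtain ⟨h, h₁⟩ := h
  refine ⟨by simpa using h, ?_⟩
  simp only [degED_mul, degD_mul, degP_mul, degGP_mul, h]
  rcases h₁ with h₁ | ⟨h₁, h₂ | ⟨h₂, h₃, h₄, h₅⟩⟩
  · exact .inl (by omega)
  · exact .inr ⟨by omega, .inl (by omega)⟩
  · have := Nat.mul_le_mul_right a.degZ h₄
    exact .inr ⟨by omega, .inr ⟨by omega, by omega, by omega,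
      h₅.imp (by omega) (Or.imp (by omega) (dlexLT_mul_left · a))⟩⟩

theorem StableLT.mul_right {u v : OpWord PDOp Z} (h : StableLT u v) (b : OpWord PDOp Z) :
    StableLT (u * b) (v * b) := by
  obtain ⟨h, h₁⟩ := h
  refine ⟨by simpa using h, ?_⟩
  simp only [degED_mul, degD_mul, degP_mul, degGP_mul, h]
  rcases h₁ with h₁ | ⟨h₁, h₂ | ⟨h₂, h₃, h₄, h₅⟩⟩
  · exact .inl (by omega)
  · exact .inr ⟨by omega, .inl (by omega)⟩
  · have := Nat.mul_le_mul_right b.degZ h₄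
    exact .inr ⟨by omega, .inr ⟨by omega, by omega, by omega,
      h₅.imp (by omega) (Or.imp (by omega) (dlexLT_mul_right b))⟩⟩

theorem StableLT.bracket {u v : OpWord PDOp Z} (h : StableLT u v) (ω : PDOp) :
    StableLT (OpWord.bracket ω u) (OpWord.bracket ω v) := by
  obtain ⟨h, h₁⟩ := h
  refine ⟨by simpa using h, ?_⟩
  cases ω <;> simpa [h] using h₁.imp_right <| And.imp_right <| Or.imp_right <| And.imp_right <|
    And.imp_right <| And.imp_right <| Or.imp_right <| Or.imp_right (dlexLT_bracket _)

theorem IsContext.stableLT {c : OpWord PDOp Z → OpWord PDOp Z} (hc : IsContext c)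
    {u v : OpWord PDOp Z} (h : StableLT u v) : StableLT (c u) (c v) := by
  induction hc with
  | id => exact h
  | mul_left a _ ih => exact ih.mul_left a
  | mul_right b _ ih => exact ih.mul_right b
  | bracket ω _ ih => exact ih.bracket ω

end OpWord

/-! ### Bracketed polynomials as a module -/

noncomputable section

namespace OpPoly

open OpWord

variable {k : Type*} [CommRing k] {Ω X Z : Type*}

theorem ofWord_mul_ofWord (u v : OpWord Ω Z) :
    (ofWord u * ofWord v : OpPoly k Ω Z) = ofWord (u * v) := by
  simp [ofWord, MonoidAlgebra.single_mul_single]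

/-- The linear extension of a map on words. -/
def mapWords (c : OpWord Ω X → OpWord Ω Z) : OpPoly k Ω X →ₗ[k] OpPoly k Ω Z where
  toFun := MonoidAlgebra.mapDomain c
  map_add' := MonoidAlgebra.mapDomain_add c
  map_smul' _ _ := MonoidAlgebra.mapDomain_smul ..

theorem mapWords_apply (c : OpWord Ω X → OpWord Ω Z) (f : OpPoly k Ω X) :
    mapWords c f = MonoidAlgebra.mapDomain c f := rfl

@[simp] theorem mapWords_ofWord (c : OpWord Ω X → OpWord Ω Z) (u : OpWord Ω X) :
    mapWords c (ofWord u : OpPoly k Ω X) = ofWord (c u) := by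
  simp [mapWords_apply, ofWord]

theorem mapWords_mapWords {Y : Type*} (c : OpWord Ω X → OpWord Ω Z)
    (d : OpWord Ω Y → OpWord Ω X) (f : OpPoly k Ω Y) :
    mapWords c (mapWords d f) = mapWords (fun u => c (d u)) f := by
  induction f using MonoidAlgebra.induction_linear with
  | zero => simp
  | add f g hf hg => simp [hf, hg]
  | single u a => simp [mapWords_apply]

theorem mapWords_id (f : OpPoly k Ω Z) : mapWords (fun u => u) f = f := by
  induction f using MonoidAlgebra.induction_linear with
  | zero => simp
  | add f g hf hg => simp [hf, hg]
  | single u a => simp [mapWords_apply]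

/-! ### The three families of elements -/

/-- The Rota–Baxter identity at the words `u`, `v`. -/
def rotaBaxter (lam : k) (u v : OpWord PDOp Z) : OpPoly k PDOp Z :=
  ofWord (.bracket .P u * .bracket .P v) - ofWord (.bracket .P (u * .bracket .P v)) -
    ofWord (.bracket .P (.bracket .P u * v)) - lam • ofWord (.bracket .P (u * v))

/-- The Leibniz rule at the words `u`, `v`. -/
def leibniz (lam : k) (u v : OpWord PDOp Z) : OpPoly k PDOp Z :=
  ofWord (.bracket .D (u * v)) - ofWord (.bracket .D u * v) - ofWord (u * .bracket .D v) -
    lam • ofWord (.bracket .D u * .bracket .D v)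

/-- The commutation relation at the word `u`. -/
def commutation (b : k) (u : OpWord PDOp Z) : OpPoly k PDOp Z :=
  ofWord (.bracket .D (.bracket .P u)) - ofWord (.bracket .P (.bracket .D u)) -
    b • ofWord (.bracket .P u)

/-- `IsGen lam b f m` says that `f` is one of the instances of the defining identities and that
`m` is its leading word. -/
inductive IsGen (lam b : k) : OpPoly k PDOp Z → OpWord PDOp Z → Prop
  | rotaBaxter (u v) : IsGen lam b (rotaBaxter lam u v) (.bracket .P u * .bracket .P v)
  | leibniz (u v) : IsGen lam b (leibniz lam u v) (.bracket .D (u * v))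
  | commutation (u) : IsGen lam b (commutation b u) (.bracket .D (.bracket .P u))

theorem bracket_eq_mapWords (ω : Ω) (f : OpPoly k Ω Z) :
    bracket ω f = mapWords (OpWord.bracket ω) f := rfl

theorem subst_eq_mapWords (σ : X → OpWord Ω Z) (f : OpPoly k Ω X) :
    subst σ f = mapWords (OpWord.subst σ) f := rfl

theorem mem_instances_iff {lam b : k} {f : OpPoly k PDOp Z} :
    f ∈ instances (ParaDRB.identities lam b) Z ↔ ∃ m, IsGen lam b f m := by
  have hR (σ : Fin 2 → OpWord PDOp Z) :
      subst σ (ParaDRB.rotaBaxter lam) = rotaBaxter lam (σ 0) (σ 1) := by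
    simp [ParaDRB.rotaBaxter, ParaDRB.P, ParaDRB.x, ParaDRB.y, bracket_eq_mapWords,
      subst_eq_mapWords, ofWord_mul_ofWord, rotaBaxter]
  have hL (σ : Fin 2 → OpWord PDOp Z) :
      subst σ (ParaDRB.leibniz lam) = leibniz lam (σ 0) (σ 1) := by
    simp [ParaDRB.leibniz, ParaDRB.D, ParaDRB.x, ParaDRB.y, bracket_eq_mapWords,
      subst_eq_mapWords, ofWord_mul_ofWord, leibniz]
  have hC (σ : Fin 2 → OpWord PDOp Z) :
      subst σ (ParaDRB.commutation b) = commutation b (σ 0) := by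
    simp [ParaDRB.commutation, ParaDRB.D, ParaDRB.P, ParaDRB.x, bracket_eq_mapWords,
      subst_eq_mapWords, commutation]
  constructor
  · rintro ⟨φ, rfl | rfl | rfl, σ, rfl⟩
    · rw [hR σ]
      exact ⟨_, .rotaBaxter _ _⟩
    · rw [hL σ]
      exact ⟨_, .leibniz _ _⟩
    · rw [hC σ]
      exact ⟨_, .commutation _⟩
  · rintro ⟨m, ⟨u, v⟩ | ⟨u, v⟩ | ⟨u⟩⟩
    · exact ⟨ParaDRB.rotaBaxter lam, by simp [ParaDRB.identities], ![u, v], by simp [hR]⟩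
    · exact ⟨ParaDRB.leibniz lam, by simp [ParaDRB.identities], ![u, v], by simp [hL]⟩
    · exact ⟨ParaDRB.commutation b, by simp [ParaDRB.identities], fun _ => u, by simp [hC]⟩

end OpPoly

/-! ### Leading words -/

namespace OpWord

variable {Z : Type*} [LinearOrder Z] (u v : OpWord PDOp Z)

theorem stableLT_rotaBaxter_left :
    StableLT (bracket .P (u * bracket .P v)) (bracket .P u * bracket .P v) := by
  have := u.degZ_pos
  have := v.degZ_pos
  refine ⟨by simp, .inr ⟨by simp, .inr ⟨by simp, ?_, ?_, .inl ?_⟩⟩⟩ <;>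
    simp only [degP_mul, degGP_mul, degZ_bracket, degGP_bracket, degP_bracket_P,
      add_mul, one_mul] <;> omega

theorem stableLT_rotaBaxter_right :
    StableLT (bracket .P (bracket .P u * v)) (bracket .P u * bracket .P v) := by
  have := u.degZ_pos
  have := v.degZ_pos
  refine ⟨by simp, .inr ⟨by simp, .inr ⟨by simp, ?_, ?_, .inl ?_⟩⟩⟩ <;>
    simp only [degP_mul, degGP_mul, degZ_bracket, degGP_bracket, degP_bracket_P,
      add_mul, one_mul] <;> omega

theorem stableLT_rotaBaxter_mul :
    StableLT (bracket .P (u * v)) (bracket .P u * bracket .P v) := by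
  refine ⟨by simp, .inr ⟨by simp, .inr ⟨by simp, ?_, ?_, .inr <| .inl ?_⟩⟩⟩ <;>
    simp only [degP_mul, degGP_mul, degZ_bracket, degGP_bracket, degP_bracket_P,
      add_mul, one_mul] <;> omega

theorem stableLT_leibniz_left : StableLT (bracket .D u * v) (bracket .D (u * v)) := by
  have := u.degZ_pos
  have := v.degZ_pos
  refine ⟨by simp, .inl ?_⟩
  simp only [degED_mul, degED_bracket_D, degZ_mul]
  omega

theorem stableLT_leibniz_right : StableLT (u * bracket .D v) (bracket .D (u * v)) := by
  have := u.degZ_pos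
  have := v.degZ_pos
  refine ⟨by simp, .inl ?_⟩
  simp only [degED_mul, degED_bracket_D, degZ_mul]
  omega

theorem stableLT_leibniz_mul :
    StableLT (bracket .D u * bracket .D v) (bracket .D (u * v)) := by
  have := u.degZ_pos
  have := v.degZ_pos
  refine ⟨by simp, .inl ?_⟩
  simp only [degED_mul, degED_bracket_D, degZ_mul]
  omega

theorem stableLT_commutation_swap :
    StableLT (bracket .P (bracket .D u)) (bracket .D (bracket .P u)) := by
  simp [StableLT, bracket_P_dlexLT_bracket_D]

theorem stableLT_commutation_P : StableLT (bracket .P u) (bracket .D (bracket .P u)) := by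
  refine ⟨by simp, ?_⟩
  rcases (u.degZ - 1).eq_zero_or_pos with h | h
  · exact .inr ⟨by simp [h], .inl (by simp)⟩
  · exact .inl (by simpa using h)

end OpWord

namespace OpPoly

open OpWord

variable {k : Type*} [CommRing k] {Z : Type*}

theorem ofWord_mem_span {p : OpWord PDOp Z → Prop} {u : OpWord PDOp Z} (h : p u) :
    (ofWord u : OpPoly k PDOp Z) ∈ Submodule.span k (ofWord '' {u | p u}) :=
  Submodule.subset_span ⟨u, h, rfl⟩

theorem coeff_eq_zero_of_mem_span {p : OpWord PDOp Z → Prop} {f : OpPoly k PDOp Z}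
    (hf : f ∈ Submodule.span k (ofWord '' {u | p u})) {u : OpWord PDOp Z} (hu : ¬ p u) :
    f.coeff u = 0 := by
  induction hf using Submodule.span_induction with
  | mem f hf =>
    obtain ⟨v, hv, rfl⟩ := hf
    exact Finsupp.single_eq_of_ne fun h => hu (h ▸ hv)
  | zero => rfl
  | add f g _ _ hf hg => simp [hf, hg]
  | smul a f _ hf => simp [hf]

variable [LinearOrder Z]

theorem IsGen.sub_mem_span {lam b : k} {f : OpPoly k PDOp Z} {m : OpWord PDOp Z}
    (h : IsGen lam b f m) :
    ofWord m - f ∈ Submodule.span k (ofWord '' {u : OpWord PDOp Z | StableLT u m}) := by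
  cases h with
  | rotaBaxter u v =>
    rw [OpPoly.rotaBaxter, sub_sub, sub_sub, sub_sub_cancel]
    exact add_mem (ofWord_mem_span (stableLT_rotaBaxter_left u v)) <|
      add_mem (ofWord_mem_span (stableLT_rotaBaxter_right u v)) <|
      Submodule.smul_mem _ _ (ofWord_mem_span (stableLT_rotaBaxter_mul u v))
  | leibniz u v =>
    rw [OpPoly.leibniz, sub_sub, sub_sub, sub_sub_cancel]
    exact add_mem (ofWord_mem_span (stableLT_leibniz_left u v)) <|
      add_mem (ofWord_mem_span (stableLT_leibniz_right u v)) <|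
      Submodule.smul_mem _ _ (ofWord_mem_span (stableLT_leibniz_mul u v))
  | commutation u =>
    rw [OpPoly.commutation, sub_sub, sub_sub_cancel]
    exact add_mem (ofWord_mem_span (stableLT_commutation_swap u)) <|
      Submodule.smul_mem _ _ (ofWord_mem_span (stableLT_commutation_P u))

theorem IsGen.coeff_eq_one {lam b : k} {f : OpPoly k PDOp Z} {m : OpWord PDOp Z}
    (h : IsGen lam b f m) : f.coeff m = 1 := by
  have := coeff_eq_zero_of_mem_span h.sub_mem_span (u := m) fun h => h.ne rfl
  rw [MonoidAlgebra.coeff_sub, Finsupp.sub_apply, sub_eq_zero] at this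
  rw [← this]
  exact Finsupp.single_eq_same

theorem IsGen.coeff_eq_zero {lam b : k} {f : OpPoly k PDOp Z} {m u : OpWord PDOp Z}
    (h : IsGen lam b f m) (hne : u ≠ m) (hu : ¬ StableLT u m) : f.coeff u = 0 := by
  have := coeff_eq_zero_of_mem_span h.sub_mem_span hu
  rw [MonoidAlgebra.coeff_sub, Finsupp.sub_apply, sub_eq_zero] at this
  rw [← this]
  exact Finsupp.single_eq_of_ne hne

theorem IsGen.isLeading [Nontrivial k] {le : OpWord PDOp Z → OpWord PDOp Z → Prop}
    (hrefl : ∀ u, le u u) (hle : ∀ u v, StableLT u v → le u v) {lam b : k}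
    {f : OpPoly k PDOp Z} {m : OpWord PDOp Z}
    (h : IsGen lam b f m) : IsLeading le f m := by
  refine ⟨by rw [h.coeff_eq_one]; exact one_ne_zero, fun u hu => ?_⟩
  by_cases hne : u = m
  · rw [hne]
    exact hrefl m
  · by_contra hlt
    exact hu (h.coeff_eq_zero hne fun h' => hlt (hle _ _ h'))

/-! ### Trivial elements -/

/-- The combinations of the elements `q|_s`, with `s` an instance of a defining identity, whose
leading words are stably smaller than `w`. -/
def trivialSubmodule (lam b : k) (w : OpWord PDOp Z) : Submodule k (OpPoly k PDOp Z) :=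
  Submodule.span k {x | ∃ c f m, IsContext c ∧ IsGen lam b f m ∧ StableLT (c m) w ∧
    x = mapWords c f}

theorem mapWords_mem_trivialSubmodule {lam b : k} {w : OpWord PDOp Z}
    {c : OpWord PDOp Z → OpWord PDOp Z} (hc : IsContext c) {f : OpPoly k PDOp Z}
    {m : OpWord PDOp Z} (hf : IsGen lam b f m) (h : StableLT (c m) w) :
    mapWords c f ∈ trivialSubmodule lam b w :=
  Submodule.subset_span ⟨c, f, m, hc, hf, h, rfl⟩

/-- An inclusion composition inside an argument of an identity is trivial. Here `Φ` is the
identity as a linear function of that argument, with leading context `L`. -/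
theorem nested_mem_trivialSubmodule {lam b : k} {Φ : OpPoly k PDOp Z →ₗ[k] OpPoly k PDOp Z}
    {L : OpWord PDOp Z → OpWord PDOp Z} (hL : IsContext L)
    (hΦ : ∀ u, IsGen lam b (Φ (ofWord u)) (L u))
    (hspan : mapWords L - Φ ∈ Submodule.span k
      {Ψ | ∃ κ, IsContext κ ∧ (∀ u, StableLT (κ u) (L u)) ∧ Ψ = mapWords κ})
    {c : OpWord PDOp Z → OpWord PDOp Z} (hc : IsContext c) {g : OpPoly k PDOp Z}
    {m : OpWord PDOp Z} (hg : IsGen lam b g m) :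
    Φ (ofWord (c m)) - mapWords (fun x => L (c x)) g ∈ trivialSubmodule lam b (L (c m)) := by
  have h₁ : Φ (mapWords c (ofWord m - g)) ∈ trivialSubmodule lam b (L (c m)) := by
    have := hg.sub_mem_span
    generalize ofWord m - g = f at this
    induction this using Submodule.span_induction with
    | mem f hf =>
      obtain ⟨v, hv, rfl⟩ := hf
      rw [mapWords_ofWord, ← mapWords_id (Φ _)]
      exact mapWords_mem_trivialSubmodule .id (hΦ _) (hL.stableLT (hc.stableLT hv))
    | zero => simp
    | add f g _ _ hf hg => simpa using add_mem hf hg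
    | smul a f _ hf => simpa using Submodule.smul_mem _ _ hf
  have h₂ : (mapWords L - Φ : OpPoly k PDOp Z →ₗ[k] OpPoly k PDOp Z) (mapWords c g) ∈
      trivialSubmodule lam b (L (c m)) := by
    generalize mapWords L - Φ = Ψ at hspan
    induction hspan using Submodule.span_induction with
    | mem Ψ hΨ =>
      obtain ⟨κ, hκ, hlt, rfl⟩ := hΨ
      rw [mapWords_mapWords]
      refine mapWords_mem_trivialSubmodule (c := fun x => κ (c x)) ?_ hg (hlt _)
      clear hlt
      induction hκ with
      | id => exact hc
      | mul_left a _ ih => exact ih.mul_left a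
      | mul_right a _ ih => exact ih.mul_right a
      | bracket ω _ ih => exact ih.bracket ω
    | zero => simp
    | add f g _ _ hf hg => simpa using add_mem hf hg
    | smul a f _ hf => simpa using Submodule.smul_mem _ _ hf
  have := sub_mem h₁ h₂
  rw [map_sub, map_sub, mapWords_ofWord, LinearMap.sub_apply, mapWords_mapWords] at this
  convert this using 1
  abel

end OpPoly

end

noncomputable section

namespace OpPoly

open OpWord

local notation "𝐃" => OpWord.bracket PDOp.D
local notation "𝐏" => OpWord.bracket PDOp.P

variable {k : Type*} [CommRing k] {Z : Type*} {lam b : k}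

theorem IsGen.ne_bracket_P {f : OpPoly k PDOp Z} {m : OpWord PDOp Z} (h : IsGen lam b f m)
    (u : OpWord PDOp Z) : m ≠ 𝐏 u := by
  cases h with
  | rotaBaxter => exact (bracket_ne_mul _ _ _ _).symm
  | leibniz => simp [bracket_inj]
  | commutation => simp [bracket_inj]

/-- A leading word of breadth at least two is that of a Rota–Baxter identity. -/
theorem IsGen.eq_rotaBaxter {f : OpPoly k PDOp Z} {m : OpWord PDOp Z} (h : IsGen lam b f m)
    (hm : 2 ≤ m.breadth) :
    ∃ u v, m = 𝐏 u * 𝐏 v ∧ f = OpPoly.rotaBaxter lam u v := by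
  cases h with
  | rotaBaxter u v => exact ⟨u, v, rfl, rfl⟩
  | leibniz => simp at hm
  | commutation => simp at hm

theorem IsGen.breadth_le_two {f : OpPoly k PDOp Z} {m : OpWord PDOp Z} (h : IsGen lam b f m) :
    m.breadth ≤ 2 := by
  cases h <;> simp

/-- A leading word that is a product of two words determines both as `P`-brackets. -/
theorem IsGen.eq_rotaBaxter_of_mul {f : OpPoly k PDOp Z} {g₁ g₂ : OpWord PDOp Z}
    (h : IsGen lam b f (g₁ * g₂)) :
    ∃ u v, g₁ = 𝐏 u ∧ g₂ = 𝐏 v ∧ f = OpPoly.rotaBaxter lam u v := by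
  have h₁ := g₁.breadth_pos
  have h₂ := g₂.breadth_pos
  obtain ⟨u, v, h', rfl⟩ := h.eq_rotaBaxter (by rw [breadth_mul]; omega)
  have := congrArg breadth h'
  simp only [breadth_mul, breadth_bracket] at this
  obtain ⟨rfl, rfl⟩ := mul_eq_mul_of_breadth_eq h' (by rw [breadth_bracket]; omega)
  exact ⟨u, v, rfl, rfl, rfl⟩

variable [LinearOrder Z]

theorem isTrivialMod_of_mem_trivialSubmodule [Nontrivial k]
    {le : OpWord PDOp Z → OpWord PDOp Z → Prop}
    (hrefl : ∀ u, le u u) (hle : ∀ u v, StableLT u v → le u v)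
    {w : OpWord PDOp Z} {f : OpPoly k PDOp Z} (hf : f ∈ trivialSubmodule lam b w) :
    IsTrivialMod le (instances (ParaDRB.identities lam b) Z) w f := by
  obtain ⟨a, ha, rfl⟩ := Submodule.mem_span_set.1 hf
  have hx (x : a.support) : ∃ (q : StarWord PDOp Z) (s : OpPoly k PDOp Z),
      (s ∈ instances (ParaDRB.identities lam b) Z ∧
        ∃ m, IsLeading le s m ∧ le (q.plug m) w ∧ q.plug m ≠ w) ∧ x = plug q s := by
    obtain ⟨c, s, m, hc, hs, hlt, hx⟩ := ha x.2
    obtain ⟨q, rfl⟩ := hc.exists_starWord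
    exact ⟨q, s, ⟨mem_instances_iff.2 ⟨m, hs⟩, m, hs.isLeading hrefl hle, hle _ _ hlt, hlt.ne⟩, hx⟩
  choose q s h h' using hx
  let e := a.support.equivFin
  refine ⟨a.support.card, fun i => a (e.symm i), fun i => q (e.symm i), fun i => s (e.symm i),
    fun i => ⟨Finsupp.mem_support_iff.1 (e.symm i).2, h _⟩, ?_⟩
  rw [Finsupp.sum, ← Finset.sum_coe_sort, ← e.symm.sum_comp]
  exact Finset.sum_congr rfl fun i _ => by rw [← h']

/-- The intersection composition of two Rota–Baxter identities is trivial. -/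
theorem rotaBaxter_overlap_mem (u v t : OpWord PDOp Z) :
    rotaBaxter lam u v * ofWord (𝐏 t) - ofWord (𝐏 u) * rotaBaxter lam v t ∈
      trivialSubmodule lam b (𝐏 u * 𝐏 v * 𝐏 t) := by
  have key : rotaBaxter lam u v * ofWord (𝐏 t) -
        ofWord (𝐏 u) * rotaBaxter lam v t =
      rotaBaxter lam u (v * 𝐏 t) + rotaBaxter lam u (𝐏 v * t) +
      lam • rotaBaxter lam u (v * t) - rotaBaxter lam (u * 𝐏 v) t -
      rotaBaxter lam (𝐏 u * v) t - lam • rotaBaxter lam (u * v) t +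
      mapWords (fun x => 𝐏 (x * t)) (rotaBaxter lam u v) -
      mapWords (fun x => 𝐏 (u * x)) (rotaBaxter lam v t) := by
    simp only [rotaBaxter, map_sub, map_smul, mapWords_ofWord, sub_mul, mul_sub, smul_mul_assoc,
      mul_smul_comm, ofWord_mul_ofWord, mul_assoc]
    module
  have hr (u v : OpWord PDOp Z) {w : OpWord PDOp Z}
      (h : StableLT (𝐏 u * 𝐏 v) w) :
      rotaBaxter lam u v ∈ trivialSubmodule lam b w := by
    rw [← mapWords_id (rotaBaxter lam u v)]
    exact mapWords_mem_trivialSubmodule .id (.rotaBaxter u v) h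
  have h₁ := stableLT_rotaBaxter_left u v
  have h₂ := stableLT_rotaBaxter_right u v
  have h₃ := stableLT_rotaBaxter_mul u v
  have h₁' := (stableLT_rotaBaxter_left v t).mul_left (𝐏 u)
  have h₂' := (stableLT_rotaBaxter_right v t).mul_left (𝐏 u)
  have h₃' := (stableLT_rotaBaxter_mul v t).mul_left (𝐏 u)
  rw [← mul_assoc] at h₁' h₂' h₃'
  have h₄ := (stableLT_rotaBaxter_right u (𝐏 v * t)).trans h₂'
  have h₅ := (stableLT_rotaBaxter_left (u * 𝐏 v) t).trans (h₁.mul_right _)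
  rw [← mul_assoc] at h₄
  rw [mul_assoc u] at h₅
  rw [key]
  refine sub_mem (add_mem (sub_mem (sub_mem (sub_mem (add_mem (add_mem ?_ ?_)
    (Submodule.smul_mem _ _ ?_)) ?_) ?_) (Submodule.smul_mem _ _ ?_)) ?_) ?_
  · exact hr _ _ h₁'
  · exact hr _ _ h₂'
  · exact hr _ _ h₃'
  · exact hr _ _ (h₁.mul_right _)
  · exact hr _ _ (h₂.mul_right _)
  · exact hr _ _ (h₃.mul_right _)
  · exact mapWords_mem_trivialSubmodule ((IsContext.id.mul_right _).bracket _)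
      (.rotaBaxter u v) h₄
  · exact mapWords_mem_trivialSubmodule ((IsContext.id.mul_left _).bracket _)
      (.rotaBaxter v t) h₅

/-- Two Leibniz rules with the same leading word differ by a trivial element. -/
theorem leibniz_sub_leibniz_mem (u t v : OpWord PDOp Z) :
    leibniz lam u (t * v) - leibniz lam (u * t) v ∈
      trivialSubmodule lam b (𝐃 (u * t * v)) := by
  have key : leibniz lam u (t * v) - leibniz lam (u * t) v =
      mapWords (fun x => x * v) (leibniz lam u t) +
      lam • mapWords (fun x => x * 𝐃 v) (leibniz lam u t) -
      mapWords (fun x => u * x) (leibniz lam t v) -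
      lam • mapWords (fun x => 𝐃 u * x) (leibniz lam t v) := by
    simp only [leibniz, map_sub, map_smul, mapWords_ofWord, mul_assoc]
    module
  rw [key]
  refine sub_mem (sub_mem (add_mem ?_ (Submodule.smul_mem _ _ ?_)) ?_) (Submodule.smul_mem _ _ ?_)
  · exact mapWords_mem_trivialSubmodule (IsContext.id.mul_right _) (.leibniz u t)
      (stableLT_leibniz_left _ _)
  · exact mapWords_mem_trivialSubmodule (IsContext.id.mul_right _) (.leibniz u t)
      (stableLT_leibniz_mul _ _)
  · exact mapWords_mem_trivialSubmodule (IsContext.id.mul_left _) (.leibniz t v)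
      (mul_assoc u t v ▸ stableLT_leibniz_right _ _)
  · exact mapWords_mem_trivialSubmodule (IsContext.id.mul_left _) (.leibniz t v)
      (mul_assoc u t v ▸ stableLT_leibniz_mul _ _)

/-- The inclusion composition of the Leibniz rule and the Rota–Baxter identity is trivial. -/
theorem leibniz_sub_rotaBaxter_mem (h : lam = 0 ∨ b = 0) (s t : OpWord PDOp Z) :
    leibniz lam (𝐏 s) (𝐏 t) - mapWords 𝐃 (rotaBaxter lam s t) ∈
      trivialSubmodule lam b (𝐃 (𝐏 s * 𝐏 t)) := by
  have key : leibniz lam (𝐏 s) (𝐏 t) -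
        mapWords 𝐃 (rotaBaxter lam s t) =
      (commutation b (s * 𝐏 t) + commutation b (𝐏 s * t) +
        lam • commutation b (s * t)) -
      (mapWords (fun x => x * 𝐏 t) (commutation b s) +
        mapWords (fun x => 𝐏 s * x) (commutation b t) +
        lam • mapWords (fun x => x * 𝐃 (𝐏 t)) (commutation b s) +
        lam • mapWords (fun x => 𝐏 (𝐃 s) * x) (commutation b t)) +
      (mapWords 𝐏 (leibniz lam s (𝐏 t)) +
        mapWords 𝐏 (leibniz lam (𝐏 s) t) +
        lam • mapWords 𝐏 (leibniz lam s t)) +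
      (mapWords (fun x => 𝐏 (s * x)) (commutation b t) +
        lam • mapWords (fun x => 𝐏 (𝐃 s * x)) (commutation b t) +
        mapWords (fun x => 𝐏 (x * t)) (commutation b s) +
        lam • mapWords (fun x => 𝐏 (x * 𝐃 t)) (commutation b s)) -
      (rotaBaxter lam (𝐃 s) t + rotaBaxter lam s (𝐃 t) +
        lam • rotaBaxter lam (𝐃 s) (𝐃 t) +
        (2 * b) • rotaBaxter lam s t) := by
    rcases h with rfl | rfl <;>
    · simp only [rotaBaxter, leibniz, commutation, map_sub, map_smul, mapWords_ofWord, zero_smul,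
        map_zero]
      module
  have hr (u v : OpWord PDOp Z) {w : OpWord PDOp Z}
      (h : StableLT (𝐏 u * 𝐏 v) w) :
      rotaBaxter lam u v ∈ trivialSubmodule lam b w := by
    rw [← mapWords_id (rotaBaxter lam u v)]
    exact mapWords_mem_trivialSubmodule .id (.rotaBaxter u v) h
  have hc (u : OpWord PDOp Z) {w : OpWord PDOp Z}
      (h : StableLT (𝐃 (𝐏 u)) w) :
      commutation b u ∈ trivialSubmodule lam b w := by
    rw [← mapWords_id (commutation b u)]
    exact mapWords_mem_trivialSubmodule .id (.commutation u) h
  have h₁ := stableLT_leibniz_left (𝐏 s) (𝐏 t)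
  have h₂ := stableLT_leibniz_right (𝐏 s) (𝐏 t)
  have h₃ := stableLT_leibniz_mul (𝐏 s) (𝐏 t)
  have h₄ := (stableLT_rotaBaxter_left s t).bracket .D
  have h₅ := (stableLT_rotaBaxter_right s t).bracket .D
  have h₆ := (stableLT_rotaBaxter_mul s t).bracket .D
  have h₇ := (stableLT_commutation_swap _).trans h₄
  have h₈ := (stableLT_commutation_swap _).trans h₅
  have h₉ := (stableLT_commutation_swap _).trans h₆
  have h₁₀ := ((stableLT_commutation_swap s).mul_right (𝐃 (𝐏 t))).trans h₃
  rw [key]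
  refine sub_mem (add_mem (add_mem (sub_mem
    (add_mem (add_mem (hc _ h₄) (hc _ h₅)) (Submodule.smul_mem _ _ (hc _ h₆)))
    (add_mem (add_mem (add_mem ?_ ?_) (Submodule.smul_mem _ _ ?_)) (Submodule.smul_mem _ _ ?_)))
    (add_mem (add_mem ?_ ?_) (Submodule.smul_mem _ _ ?_)))
    (add_mem (add_mem (add_mem ?_ (Submodule.smul_mem _ _ ?_)) ?_) (Submodule.smul_mem _ _ ?_)))
    (add_mem (add_mem (add_mem (hr _ _ ?_) (hr _ _ ?_)) (Submodule.smul_mem _ _ (hr _ _ ?_)))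
      (Submodule.smul_mem _ _ (hr _ _ ?_)))
  · exact mapWords_mem_trivialSubmodule (IsContext.id.mul_right _) (.commutation s) h₁
  · exact mapWords_mem_trivialSubmodule (IsContext.id.mul_left _) (.commutation t) h₂
  · exact mapWords_mem_trivialSubmodule (IsContext.id.mul_right _) (.commutation s) h₃
  · exact mapWords_mem_trivialSubmodule (IsContext.id.mul_left _) (.commutation t) h₁₀
  · exact mapWords_mem_trivialSubmodule (IsContext.id.bracket _) (.leibniz s _) h₇
  · exact mapWords_mem_trivialSubmodule (IsContext.id.bracket _) (.leibniz _ t) h₈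
  · exact mapWords_mem_trivialSubmodule (IsContext.id.bracket _) (.leibniz s t) h₉
  · exact mapWords_mem_trivialSubmodule ((IsContext.id.mul_left _).bracket _) (.commutation t)
      (((stableLT_leibniz_right _ _).bracket _).trans h₇)
  · exact mapWords_mem_trivialSubmodule ((IsContext.id.mul_left _).bracket _) (.commutation t)
      (((stableLT_leibniz_mul _ _).bracket _).trans h₇)
  · exact mapWords_mem_trivialSubmodule ((IsContext.id.mul_right _).bracket _) (.commutation s)
      (((stableLT_leibniz_left _ _).bracket _).trans h₈)
  · exact mapWords_mem_trivialSubmodule ((IsContext.id.mul_right _).bracket _) (.commutation s)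
      (((stableLT_leibniz_mul _ _).bracket _).trans h₈)
  · exact ((stableLT_commutation_swap s).mul_right _).trans h₁
  · exact ((stableLT_commutation_swap t).mul_left _).trans h₂
  · exact ((stableLT_commutation_swap t).mul_left _).trans h₁₀
  · exact ((stableLT_commutation_P s).mul_right _).trans h₁

section nested

variable {c : OpWord PDOp Z → OpWord PDOp Z} {g : OpPoly k PDOp Z} {m : OpWord PDOp Z}

theorem mapWords_mem_span {L κ : OpWord PDOp Z → OpWord PDOp Z} (hκ : IsContext κ)
    (h : ∀ u, StableLT (κ u) (L u)) :
    (mapWords κ : OpPoly k PDOp Z →ₗ[k] OpPoly k PDOp Z) ∈ Submodule.span k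
      {Ψ | ∃ κ, IsContext κ ∧ (∀ u, StableLT (κ u) (L u)) ∧ Ψ = mapWords κ} :=
  Submodule.subset_span ⟨κ, hκ, h, rfl⟩

theorem rotaBaxter_nested_left_mem (hc : IsContext c) (hg : IsGen lam b g m)
    (v : OpWord PDOp Z) :
    rotaBaxter lam (c m) v - mapWords (fun x => 𝐏 (c x) * 𝐏 v) g ∈
      trivialSubmodule lam b (𝐏 (c m) * 𝐏 v) := by
  have := nested_mem_trivialSubmodule (lam := lam) (b := b)
    (Φ := mapWords (fun x => 𝐏 x * 𝐏 v) -
      mapWords (fun x => 𝐏 (x * 𝐏 v)) -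
      mapWords (fun x => 𝐏 (𝐏 x * v)) -
      lam • mapWords (fun x => 𝐏 (x * v)))
    ((IsContext.id.bracket .P).mul_right (𝐏 v))
    (fun u => by simpa [rotaBaxter] using IsGen.rotaBaxter (lam := lam) (b := b) u v) ?_ hc hg
  · simpa [rotaBaxter] using this
  · rw [sub_sub, sub_sub, sub_sub_cancel]
    exact add_mem (mapWords_mem_span ((IsContext.id.mul_right _).bracket _)
        fun _ => stableLT_rotaBaxter_left _ _) <|
      add_mem (mapWords_mem_span (((IsContext.id.bracket _).mul_right _).bracket _)
        fun _ => stableLT_rotaBaxter_right _ _) <|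
      Submodule.smul_mem _ _ (mapWords_mem_span ((IsContext.id.mul_right _).bracket _)
        fun _ => stableLT_rotaBaxter_mul _ _)

theorem rotaBaxter_nested_right_mem (hc : IsContext c) (hg : IsGen lam b g m)
    (u : OpWord PDOp Z) :
    rotaBaxter lam u (c m) - mapWords (fun x => 𝐏 u * 𝐏 (c x)) g ∈
      trivialSubmodule lam b (𝐏 u * 𝐏 (c m)) := by
  have := nested_mem_trivialSubmodule (lam := lam) (b := b)
    (Φ := mapWords (fun x => 𝐏 u * 𝐏 x) -
      mapWords (fun x => 𝐏 (u * 𝐏 x)) -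
      mapWords (fun x => 𝐏 (𝐏 u * x)) -
      lam • mapWords (fun x => 𝐏 (u * x)))
    ((IsContext.id.bracket .P).mul_left (𝐏 u))
    (fun v => by simpa [rotaBaxter] using IsGen.rotaBaxter (lam := lam) (b := b) u v) ?_ hc hg
  · simpa [rotaBaxter] using this
  · rw [sub_sub, sub_sub, sub_sub_cancel]
    exact add_mem (mapWords_mem_span (((IsContext.id.bracket _).mul_left _).bracket _)
        fun _ => stableLT_rotaBaxter_left _ _) <|
      add_mem (mapWords_mem_span ((IsContext.id.mul_left _).bracket _)
        fun _ => stableLT_rotaBaxter_right _ _) <|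
      Submodule.smul_mem _ _ (mapWords_mem_span ((IsContext.id.mul_left _).bracket _)
        fun _ => stableLT_rotaBaxter_mul _ _)

theorem leibniz_nested_left_mem (hc : IsContext c) (hg : IsGen lam b g m)
    (v : OpWord PDOp Z) :
    leibniz lam (c m) v - mapWords (fun x => 𝐃 (c x * v)) g ∈
      trivialSubmodule lam b (𝐃 (c m * v)) := by
  have := nested_mem_trivialSubmodule (lam := lam) (b := b)
    (Φ := mapWords (fun x => 𝐃 (x * v)) - mapWords (fun x => 𝐃 x * v) -
      mapWords (fun x => x * 𝐃 v) -
      lam • mapWords (fun x => 𝐃 x * 𝐃 v))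
    ((IsContext.id.mul_right v).bracket .D)
    (fun u => by simpa [leibniz] using IsGen.leibniz (lam := lam) (b := b) u v) ?_ hc hg
  · simpa [leibniz] using this
  · rw [sub_sub, sub_sub, sub_sub_cancel]
    exact add_mem (mapWords_mem_span ((IsContext.id.bracket _).mul_right _)
        fun _ => stableLT_leibniz_left _ _) <|
      add_mem (mapWords_mem_span (IsContext.id.mul_right _)
        fun _ => stableLT_leibniz_right _ _) <|
      Submodule.smul_mem _ _ (mapWords_mem_span ((IsContext.id.bracket _).mul_right _)
        fun _ => stableLT_leibniz_mul _ _)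

theorem leibniz_nested_right_mem (hc : IsContext c) (hg : IsGen lam b g m)
    (u : OpWord PDOp Z) :
    leibniz lam u (c m) - mapWords (fun x => 𝐃 (u * c x)) g ∈
      trivialSubmodule lam b (𝐃 (u * c m)) := by
  have := nested_mem_trivialSubmodule (lam := lam) (b := b)
    (Φ := mapWords (fun x => 𝐃 (u * x)) - mapWords (fun x => 𝐃 u * x) -
      mapWords (fun x => u * 𝐃 x) -
      lam • mapWords (fun x => 𝐃 u * 𝐃 x))
    ((IsContext.id.mul_left u).bracket .D)
    (fun v => by simpa [leibniz] using IsGen.leibniz (lam := lam) (b := b) u v) ?_ hc hg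
  · simpa [leibniz] using this
  · rw [sub_sub, sub_sub, sub_sub_cancel]
    exact add_mem (mapWords_mem_span (IsContext.id.mul_left _)
        fun _ => stableLT_leibniz_left _ _) <|
      add_mem (mapWords_mem_span ((IsContext.id.bracket _).mul_left _)
        fun _ => stableLT_leibniz_right _ _) <|
      Submodule.smul_mem _ _ (mapWords_mem_span ((IsContext.id.bracket _).mul_left _)
        fun _ => stableLT_leibniz_mul _ _)

theorem commutation_nested_mem (hc : IsContext c) (hg : IsGen lam b g m) :
    commutation b (c m) - mapWords (fun x => 𝐃 (𝐏 (c x))) g ∈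
      trivialSubmodule lam b (𝐃 (𝐏 (c m))) := by
  have := nested_mem_trivialSubmodule (lam := lam) (b := b)
    (Φ := mapWords (fun x => 𝐃 (𝐏 x)) -
      mapWords (fun x => 𝐏 (𝐃 x)) - b • mapWords (fun x => 𝐏 x))
    ((IsContext.id.bracket .P).bracket .D)
    (fun u => by simpa [commutation] using IsGen.commutation (lam := lam) (b := b) u) ?_ hc hg
  · simpa [commutation] using this
  · rw [sub_sub, sub_sub_cancel]
    exact add_mem (mapWords_mem_span ((IsContext.id.bracket _).bracket _)
        fun _ => stableLT_commutation_swap _) <|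
      Submodule.smul_mem _ _ (mapWords_mem_span (IsContext.id.bracket _)
        fun _ => stableLT_commutation_P _)

end nested

theorem leibniz_including_mem (h : lam = 0 ∨ b = 0) {u v : OpWord PDOp Z} {g : OpPoly k PDOp Z}
    {m : OpWord PDOp Z} (hg : IsGen lam b g m) {c : OpWord PDOp Z → OpWord PDOp Z}
    (hc : IsContext c) (hm : u * v = c m) :
    leibniz lam u v - mapWords (fun x => 𝐃 (c x)) g ∈
      trivialSubmodule lam b (𝐃 (u * v)) := by
  rcases hc.eq_mul hm with ⟨c', hc', rfl, rfl⟩ | ⟨c', hc', rfl, rfl⟩ | ⟨g₁, g₂, rfl, H⟩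
  · exact leibniz_nested_left_mem hc' hg v
  · exact leibniz_nested_right_mem hc' hg u
  obtain ⟨s, t, rfl, rfl, rfl⟩ := hg.eq_rotaBaxter_of_mul
  rcases H with ⟨rfl, rfl, rfl⟩ | ⟨a, rfl, rfl, rfl⟩ | ⟨d, rfl, rfl, rfl⟩ | ⟨a, d, rfl, rfl, rfl⟩
  · exact leibniz_sub_rotaBaxter_mem h s t
  · have h₁ := leibniz_sub_leibniz_mem (lam := lam) (b := b) a (𝐏 s) (𝐏 t)
    have h₂ := leibniz_nested_right_mem .id hg a
    rw [← mul_assoc] at h₂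
    simpa using sub_mem h₂ h₁
  · have h₁ := leibniz_sub_leibniz_mem (lam := lam) (b := b) (𝐏 s) (𝐏 t) d
    have h₂ := leibniz_nested_left_mem .id hg d
    rw [← mul_assoc]
    simpa using add_mem h₁ h₂
  · have h₁ := leibniz_sub_leibniz_mem (lam := lam) (b := b) a (𝐏 s) (𝐏 t * d)
    have h₂ := leibniz_nested_right_mem (IsContext.id.mul_right d) hg a
    simp only [mul_assoc] at h₁ h₂ ⊢
    simpa using sub_mem h₂ h₁

theorem including_mem (h : lam = 0 ∨ b = 0) {f g : OpPoly k PDOp Z} {mf mg : OpWord PDOp Z}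
    (hf : IsGen lam b f mf) (hg : IsGen lam b g mg) {c : OpWord PDOp Z → OpWord PDOp Z}
    (hc : IsContext c) (hm : mf = c mg) :
    f - mapWords c g ∈ trivialSubmodule lam b mf := by
  cases hf with
  | rotaBaxter u v =>
    rcases hc.eq_mul hm with ⟨c', hc', hu, rfl⟩ | ⟨c', hc', hv, rfl⟩ | ⟨g₁, g₂, rfl, H⟩
    · rcases hc'.eq_bracket hu with ⟨h', -⟩ | ⟨d, hd, rfl, rfl⟩
      · exact absurd h' (hg.ne_bracket_P u)
      · exact rotaBaxter_nested_left_mem hd hg v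
    · rcases hc'.eq_bracket hv with ⟨h', -⟩ | ⟨d, hd, rfl, rfl⟩
      · exact absurd h' (hg.ne_bracket_P v)
      · exact rotaBaxter_nested_right_mem hd hg u
    · obtain ⟨s, t, rfl, rfl, rfl⟩ := hg.eq_rotaBaxter_of_mul
      rcases H with ⟨hu, hv, rfl⟩ | ⟨a, hu, -, -⟩ | ⟨d, -, hv, -⟩ | ⟨a, d, hu, -, -⟩
      · obtain ⟨-, rfl⟩ := bracket_inj.1 hu
        obtain ⟨-, rfl⟩ := bracket_inj.1 hv
        rw [mapWords_id, sub_self]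
        exact zero_mem _
      · exact absurd hu (bracket_ne_mul _ _ _ _)
      · exact absurd hv (bracket_ne_mul _ _ _ _)
      · exact absurd hu (bracket_ne_mul _ _ _ _)
  | leibniz u v =>
    rcases hc.eq_bracket hm with ⟨rfl, rfl⟩ | ⟨c', hc', hm', rfl⟩
    · rw [mapWords_id]
      generalize hw : 𝐃 (u * v) = w at hg
      cases hg with
      | rotaBaxter => exact absurd hw (bracket_ne_mul _ _ _ _)
      | commutation => exact absurd (bracket_inj.1 hw).2.symm (bracket_ne_mul _ _ _ _)
      | leibniz u' v' =>
        rcases mul_eq_mul_cases (bracket_inj.1 hw).2 with ⟨rfl, rfl⟩ | ⟨t, rfl, rfl⟩ | ⟨t, rfl, rfl⟩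
        · rw [sub_self]
          exact zero_mem _
        · rw [← neg_sub, ← mul_assoc]
          exact neg_mem (leibniz_sub_leibniz_mem (lam := lam) (b := b) u' t v)
        · exact leibniz_sub_leibniz_mem (lam := lam) (b := b) u t v'
    · exact leibniz_including_mem h hg hc' hm'
  | commutation u =>
    rcases hc.eq_bracket hm with ⟨rfl, rfl⟩ | ⟨c', hc', hm', rfl⟩
    · rw [mapWords_id]
      generalize hw : 𝐃 (𝐏 u) = w at hg
      cases hg with
      | rotaBaxter => exact absurd hw (bracket_ne_mul _ _ _ _)
      | leibniz => exact absurd (bracket_inj.1 hw).2 (bracket_ne_mul _ _ _ _)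
      | commutation u' =>
        obtain ⟨-, rfl⟩ := bracket_inj.1 (bracket_inj.1 hw).2
        rw [sub_self]
        exact zero_mem _
    · rcases hc'.eq_bracket hm' with ⟨h', -⟩ | ⟨d, hd, rfl, rfl⟩
      · exact absurd h' (hg.ne_bracket_P u)
      · exact commutation_nested_mem hd hg

theorem intersection_mem {f g : OpPoly k PDOp Z} {mf mg μ ν : OpWord PDOp Z}
    (hf : IsGen lam b f mf) (hg : IsGen lam b g mg) (hw : mf * μ = ν * mg)
    (h₁ : max mf.breadth mg.breadth < (mf * μ).breadth)
    (h₂ : (mf * μ).breadth < mf.breadth + mg.breadth) :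
    f * ofWord μ - ofWord ν * g ∈ trivialSubmodule lam b (mf * μ) := by
  have hμ := μ.breadth_pos
  have hν := ν.breadth_pos
  have hbf := hf.breadth_le_two
  have hbg := hg.breadth_le_two
  have hb := congrArg breadth hw
  rw [breadth_mul] at h₁ h₂
  rw [breadth_mul, breadth_mul] at hb
  obtain ⟨u, v, rfl, rfl⟩ := hf.eq_rotaBaxter (by omega)
  obtain ⟨u', v', rfl, rfl⟩ := hg.eq_rotaBaxter (by omega)
  simp only [breadth_mul, breadth_bracket] at *
  rw [mul_assoc] at hw
  obtain ⟨rfl, hw'⟩ := mul_eq_mul_of_breadth_eq hw (by rw [breadth_bracket]; omega)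
  obtain ⟨hv, rfl⟩ := mul_eq_mul_of_breadth_eq hw' rfl
  obtain ⟨-, rfl⟩ := bracket_inj.1 hv
  exact rotaBaxter_overlap_mem _ _ _

theorem isGroebnerShirshovBasis_of_stableLT [Nontrivial k] (h : lam = 0 ∨ b = 0)
    {le : OpWord PDOp Z → OpWord PDOp Z → Prop} (hlin : IsWellLinearOrder le)
    (hle : ∀ u v, StableLT u v → le u v) :
    IsGroebnerShirshovBasis le (instances (ParaDRB.identities lam b) Z) := by
  have := hlin.1
  have hrefl : ∀ u, le u u := fun u => refl_of le u
  have hlead {f : OpPoly k PDOp Z} {m m' : OpWord PDOp Z} (hf : IsGen lam b f m)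
      (hm : IsLeading le f m') : m' = m := by
    have hm₀ := hf.isLeading hrefl hle
    exact antisymm_of le (hm₀.2 _ hm.1) (hm.2 _ hm₀.1)
  refine ⟨fun f hf => ?_, fun f hf g hg mf mg hmf hmg μ ν w hw hw' h₁ h₂ => ?_,
    fun f hf g hg mf mg hmf hmg q w hw hw' => ?_⟩
  · obtain ⟨m, hf⟩ := mem_instances_iff.1 hf
    exact ⟨m, hf.isLeading hrefl hle, hf.coeff_eq_one⟩
  · obtain ⟨m, hf⟩ := mem_instances_iff.1 hf
    obtain ⟨m', hg⟩ := mem_instances_iff.1 hg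
    obtain rfl := hlead hf hmf
    obtain rfl := hlead hg hmg
    subst hw
    exact isTrivialMod_of_mem_trivialSubmodule hrefl hle (intersection_mem hf hg hw' h₁ h₂)
  · obtain ⟨m, hf⟩ := mem_instances_iff.1 hf
    obtain ⟨m', hg⟩ := mem_instances_iff.1 hg
    obtain rfl := hlead hf hmf
    obtain rfl := hlead hg hmg
    subst hw
    exact isTrivialMod_of_mem_trivialSubmodule hrefl hle
      (including_mem h hf hg q.isContext_plug hw')

end OpPoly

end

theorem ParaDRB.AlgType.Admissible.eq_zero_or_eq_zero {k : Type*} [CommRing k]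
    {T : ParaDRB.AlgType} {lam b : k} (hT : T.Admissible lam b) : lam = 0 ∨ b = 0 := by
  cases T with
  | I => exact .inl hT.1
  | II => exact .inr hT.2
  | III => exact .inl hT.1

theorem mainTheorem3 {k : Type*} [CommRing k] [Nontrivial k]
    {Z : Type*} [LinearOrder Z] [WellFoundedLT Z]
    (T : ParaDRB.AlgType) (lam b : k) (hT : T.Admissible lam b) :
    (IsWellLinearOrder (OpWord.zdpLE (Z := Z)) ∧
      OpPoly.IsGroebnerShirshovBasis (OpWord.zdpLE (Z := Z))
        (OpPoly.instances (ParaDRB.identities lam b) Z)) ∧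
    (IsMonomialOrder (OpWord.zdpLE' (Z := Z)) ∧
      OpPoly.IsGroebnerShirshovBasis (OpWord.zdpLE' (Z := Z))
        (OpPoly.instances (ParaDRB.identities lam b) Z)) :=
  ⟨⟨OpWord.isWellLinearOrder_zdpLE,
      OpPoly.isGroebnerShirshovBasis_of_stableLT hT.eq_zero_or_eq_zero
        OpWord.isWellLinearOrder_zdpLE fun _ _ h => h.zdpLE⟩,
    OpWord.isMonomialOrder_zdpLE',
    OpPoly.isGroebnerShirshovBasis_of_stableLT hT.eq_zero_or_eq_zero
      OpWord.isWellLinearOrder_zdpLE' fun _ _ h => h.zdpLE'⟩
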